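/- **Setting.** Let $\mathcal H=\bigoplus_{d\ge 0}\mathcal H_d$ be a connected graded commutative Hopf algebra over $\mathbb C$ with counit $\varepsilon$ and antipode $S$, and let $\mathcal A=\mathbb C((\lambda))=\mathcal A_-\oplus\mathcal A_+$ be the algebra of formal Laurent series, with $\mathcal A_-=\lambda^{-1}\mathbb C[\lambda^{-1}]$, $\mathcal A_+=\mathbb C[[\lambda]]$, projections $P_\pm$, and $R=P_+-P_-$. Let $\star$ be the convolution product of linear maps on $\mathcal H$ and $[f,g]=f\star g-g\star f$. Let $G_{\mathcal A}$ be the group of characters (unital algebra morphisms $\mathcal H\to\mathcal A$) under $\star$, with $\varphi^{-1}=\varphi\circ S$. For a commutative algebra $A$ let $\mathfrak g_A$ be the Lie algebra of infinitesimal characters $Z:\mathcal H\to A$, i.e. linear maps with $Z(hk)=Z(h)\varepsilon(k)+\varepsilon(h)Z(k)$. Each $\varphi\in G_{\mathcal A}$ has a unique Birkhoff decomposition $\varphi=\varphi_-^{-1}\star\varphi_+$ with $\varphi_\pm\in G_{\mathcal A}$, $\varphi_-(\ker\varepsilon)\subset\mathcal A_-$ and $\varphi_+(\mathcal H)\subset\mathcal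 A_+$. Let $Y(x)=|x|\,x$ and, for $s\in\mathbb C$, $\varphi^s(x)=e^{s\lambda|x|}\varphi(x)$ for homogeneous $x$ of degree $|x|$. A character $\varphi$ is *local* if $\frac{d}{ds}(\varphi^s)_-=0$. Put $\tilde R(\varphi)=\varphi^{-1}\star(\varphi\circ Y)$. For local $\varphi$ put $\tilde\beta_\varphi=\frac{d}{ds}\big|_{s=0}\,\varphi^{-1}\star\varphi^s$ and $\beta_\varphi=-\mathrm{Res}(\varphi_-)\circ Y$. For a scalar-valued character $g$ put $\mathrm{Ad}(g)Z=g\star Z\star g^{-1}$. Derivatives of $\mathcal A$-valued maps are taken at each element of $\mathcal H$ and coefficientwise in $\lambda$. **Theorem.** Let $m,n\in\mathbb Z$ and let $\varphi\in G_{\mathcal A}$ be local. The Lax pair equation $$\frac{dL}{dt}=[L,M],\qquad M=R(\lambda^{-n+2m}L),\qquad L(0)=\tilde R(\varphi),$$ has exactly one solution $L:\mathbb R\to\mathfrak g_{\mathcal A}$. For each $t\in\mathbb R$ there is exactly one $\varphi_t\in G_{\mathcal A}$ with $\tilde R(\varphi_t)=L(t)$, and $\varphi_t$ is local with $\beta_{\varphi_t}\in\mathfrak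 g_{\mathbb C}$. Moreover: (i) If $-n+2m\ge 1$, then $\varphi_t=\varphi$, and hence $\beta_{\varphi_t}=\beta_\varphi$, for all $t$. (ii) If $-n+2m\le 0$, then $t\mapsto(\varphi_t)_+(0)$ (the value at $\lambda=0$) and $t\mapsto\beta_{\varphi_t}$ are differentiable at each element of $\mathcal H$, and for all $t$ $$\frac{d\beta_{\varphi_t}}{dt}=\Big[\beta_{\varphi_t},\;-\frac{d\big((\varphi_t)_+(0)\big)}{dt}\star\big((\varphi_t)_+(0)\big)^{-1}+2\,\mathrm{Ad}\big((\varphi_t)_+(0)\big)\Big(\mathrm{Res}\big(\lambda^{-n+2m-2}\tilde\beta_{\varphi_t}\big)\Big)\Big].$$ -/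

import Mathlib

open scoped TensorProduct

noncomputable section

/-- The algebra `𝒜` of formal Laurent series in one variable `λ` over `ℂ`, with its coefficientwise
structure of `ℂ`-algebra. (It is a type synonym because Mathlib finds a second `ℂ`-algebra structure
on `HahnSeries ℤ ℂ`, through power series, that is only propositionally equal to this one.) -/
def Laurent : Type := HahnSeries ℤ ℂ

instance : CommRing Laurent := inferInstanceAs (CommRing (HahnSeries ℤ ℂ))

instance : Algebra ℂ Laurent := HahnSeries.instAlgebra (Γ := ℤ) (R := ℂ) (A := ℂ)

/-- The coefficient of `λ ^ j`. -/
def Laurent.coeff (a : Laurent) (j : ℤ) : ℂ := HahnSeries.coeff a j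

/-- The Laurent monomial `λ ^ k`. -/
def lam (k : ℤ) : Laurent := HahnSeries.single (Γ := ℤ) (R := ℂ) k 1

/-- The projection `P₋` onto the pole part `λ⁻¹ ℂ[λ⁻¹]`. -/
def projMinus : Laurent →ₗ[ℂ] Laurent := HahnSeries.truncLTLinearMap (Γ := ℤ) (V := ℂ) ℂ 0

/-- The projection `P₊` onto the holomorphic part `ℂ[[λ]]`. -/
def projPlus : Laurent →ₗ[ℂ] Laurent := LinearMap.id - projMinus

/-- The coefficient of `λ ^ j`, as a linear functional. -/
def coeffLin (j : ℤ) : Laurent →ₗ[ℂ] ℂ where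
  toFun a := a.coeff j
  map_add' _ _ := rfl
  map_smul' _ _ := rfl

/-- The exponential series `e ^ (c λ)` as a Laurent series. -/
def expLam (c : ℂ) : Laurent :=
  HahnSeries.ofPowerSeries ℤ ℂ (PowerSeries.rescale c (PowerSeries.exp ℂ))

/-- Differentiability of a curve of Laurent series, coefficient by coefficient. -/
def HasLaurentDerivAt {K : Type*} [NontriviallyNormedField K] [NormedSpace K ℂ]
    (f : K → Laurent) (f' : Laurent) (t : K) : Prop :=
  ∀ j : ℤ, HasDerivAt (fun s => (f s).coeff j) (f'.coeff j) t

section Hopf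

/-- `ℂ`-linear maps `H → A`. The multiplication on this type is the convolution product `⋆`, its
unit is the counit, and `⁅f, g⁆ = f ⋆ g - g ⋆ f`. -/
abbrev ConvMap (H A : Type*) [CommRing H] [HopfAlgebra ℂ H] [CommRing A] [Algebra ℂ A] : Type _ :=
  WithConv (H →ₗ[ℂ] A)

/-- The group `G_𝒜` of characters of `H` with values in Laurent series, i.e. of unital algebra
morphisms. The multiplication is convolution. -/
abbrev Character (H : Type*) [CommRing H] [HopfAlgebra ℂ H] : Type _ :=
  WithConv (H →ₐ[ℂ] Laurent)

variable {H : Type*} [CommRing H] [HopfAlgebra ℂ H]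

/-- The inverse of a character is `φ⁻¹ = φ ∘ S`, with `S` the antipode. -/
instance : Inv (Character H) where
  inv φ := WithConv.toConv (φ.ofConv.comp (HopfAlgebra.antipodeAlgHom ℂ H))

instance : Group (Character H) where
  inv_mul_cancel φ := by
    apply WithConv.ofConv_injective
    ext x
    have h := congrArg φ.ofConv
      (HopfAlgebra.sum_antipode_mul_eq_algebraMap_counit (Coalgebra.Repr.arbitrary ℂ x))
    change ((φ⁻¹ * φ : Character H)) x = algebraMap ℂ Laurent (Coalgebra.counit (R := ℂ) x)
    rw [AlgHom.convMul_apply, ← (Coalgebra.Repr.arbitrary ℂ x).eq]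
    simp only [map_sum, map_mul, AlgHom.commutes, Algebra.TensorProduct.lift_tmul] at h ⊢
    exact h

/-- A character regarded as a linear map. -/
def Character.toConvMap (φ : Character H) : ConvMap H Laurent :=
  WithConv.toConv φ.ofConv.toLinearMap

/-- `A`-valued infinitesimal characters (the elements of `𝔤_A`):
`Z (h k) = Z h ε(k) + ε(h) Z k`. -/
def IsInfinitesimalCharacter {A : Type*} [CommRing A] [Algebra ℂ A] (Z : ConvMap H A) : Prop :=
  ∀ h k : H, Z (h * k) =
    Z h * algebraMap ℂ A (Coalgebra.counit (R := ℂ) k) +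
      algebraMap ℂ A (Coalgebra.counit (R := ℂ) h) * Z k

/-- Post-composition of a Laurent series valued linear map with a linear map. -/
def ConvMap.post {A : Type*} [CommRing A] [Algebra ℂ A]
    (p : Laurent →ₗ[ℂ] A) (Z : ConvMap H Laurent) : ConvMap H A :=
  WithConv.toConv (p ∘ₗ Z.ofConv)

/-- The operator `R = P₊ - P₋` on Laurent series valued linear maps. -/
def rOp (Z : ConvMap H Laurent) : ConvMap H Laurent :=
  ConvMap.post (projPlus - projMinus) Z

/-- The value at `λ = 0` of a Laurent series valued map (the constant coefficient; it is used only
for maps that are holomorphic). -/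
def atZero (Z : ConvMap H Laurent) : ConvMap H ℂ :=
  ConvMap.post (coeffLin 0) Z

/-- The residue of a Laurent series valued map. -/
def residue (Z : ConvMap H Laurent) : ConvMap H ℂ :=
  ConvMap.post (coeffLin (-1)) Z

/-- The convolution inverse `g ∘ S` of a scalar valued character `g`. -/
def scalarInv (g : ConvMap H ℂ) : ConvMap H ℂ :=
  WithConv.toConv (g.ofConv ∘ₗ HopfAlgebra.antipode ℂ)

/-- The adjoint action `Ad(g) Z = g ⋆ Z ⋆ g⁻¹` of a scalar valued character. -/
def adScalar (g Z : ConvMap H ℂ) : ConvMap H ℂ :=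
  g * Z * scalarInv g

/-- Multiplication by `λ ^ k`. -/
def mulLam (k : ℤ) (Z : ConvMap H Laurent) : ConvMap H Laurent :=
  ConvMap.post (LinearMap.mulLeft ℂ (lam k)) Z

/-- `(φ₋, φ₊)` is the Birkhoff decomposition `φ = φ₋⁻¹ ⋆ φ₊`: on the augmentation ideal `φ₋` is a
polynomial in `λ⁻¹` without constant term, and `φ₊` is holomorphic in `λ`. -/
structure IsBirkhoff (φ : Character H) (p : Character H × Character H) : Prop where
  eq : φ = p.1⁻¹ * p.2
  minus : ∀ x : H, Coalgebra.counit (R := ℂ) x = 0 → projPlus (p.1 x) = 0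
  plus : ∀ x : H, projMinus (p.2 x) = 0

instance : Nonempty (Character H × Character H) := ⟨(1, 1)⟩

/-- The Birkhoff decomposition `(φ₋, φ₊)` of `φ`. -/
def birkhoff (φ : Character H) : Character H × Character H :=
  Classical.epsilon (IsBirkhoff φ)

/-- The factor `φ₋`. -/
def minusPart (φ : Character H) : Character H := (birkhoff φ).1

/-- The factor `φ₊`. -/
def plusPart (φ : Character H) : Character H := (birkhoff φ).2

/-- A grading of the algebra `H` makes it a connected graded Hopf algebra. -/
structure IsConnectedGradedHopf (𝒢 : ℕ → Submodule ℂ H) [GradedAlgebra 𝒢] : Prop where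
  comul_mem : ∀ n : ℕ, ∀ x ∈ 𝒢 n, Coalgebra.comul (R := ℂ) x ∈
    ⨆ p ∈ Finset.HasAntidiagonal.antidiagonal n,
      LinearMap.range (TensorProduct.map (𝒢 p.1).subtype (𝒢 p.2).subtype)
  counit_eq_zero : ∀ n : ℕ, n ≠ 0 → ∀ x ∈ 𝒢 n, Coalgebra.counit (R := ℂ) x = 0
  antipode_mem : ∀ n : ℕ, ∀ x ∈ 𝒢 n, HopfAlgebra.antipode ℂ x ∈ 𝒢 n
  connected : 𝒢 0 = Submodule.span ℂ {(1 : H)}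

variable (𝒢 : ℕ → Submodule ℂ H) [GradedAlgebra 𝒢]

/-- The grading biderivation `Y`, with `Y x = n x` for `x` homogeneous of degree `n`. -/
def gradingY : H →ₗ[ℂ] H :=
  (DirectSum.toModule ℂ ℕ H fun n => (n : ℂ) • (𝒢 n).subtype) ∘ₗ
    (DirectSum.decomposeLinearEquiv 𝒢).toLinearMap

/-- The linear map `H_n → 𝒜`, `x ↦ e ^ (t n λ) φ(x)`. -/
def scaleComponent (t : ℂ) (φ : Character H) (n : ℕ) : 𝒢 n →ₗ[ℂ] Laurent :=
  LinearMap.mulLeft ℂ (expLam (t * n)) ∘ₗ φ.ofConv.toLinearMap ∘ₗ (𝒢 n).subtype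

theorem expLam_zero : expLam 0 = 1 := by
  have h : PowerSeries.rescale (0 : ℂ) (PowerSeries.exp ℂ) = 1 := by
    rw [PowerSeries.rescale_zero]; simp
  exact (congrArg (HahnSeries.ofPowerSeries ℤ ℂ) h).trans (map_one _)

theorem expLam_add (a b : ℂ) : expLam (a + b) = expLam a * expLam b := by
  exact (congrArg (HahnSeries.ofPowerSeries ℤ ℂ)
    (PowerSeries.exp_mul_exp_eq_exp_add a b).symm).trans (map_mul _ _ _)

/-- The character `φ ^ t`, with `φ ^ t (x) = e ^ (t |x| λ) φ(x)` for homogeneous `x`. -/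
def scaleChar (t : ℂ) (φ : Character H) : Character H :=
  WithConv.toConv <|
    (DirectSum.toAlgebra ℂ (fun n => 𝒢 n) (scaleComponent 𝒢 t φ)
      (by
        change expLam (t * (0 : ℕ)) * φ.ofConv (1 : H) = 1
        simp [expLam_zero])
      (by
        intro i j x y
        change expLam (t * (i + j : ℕ)) * φ.ofConv ((x : H) * (y : H)) =
          (expLam (t * i) * φ.ofConv (x : H)) * (expLam (t * j) * φ.ofConv (y : H))
        rw [map_mul, Nat.cast_add, mul_add, expLam_add]
        ring)).comp
    (DirectSum.decomposeAlgEquiv 𝒢).toAlgHom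

/-- Local characters: `d/dt (φ ^ t)₋ = 0`. -/
def IsLocalCharacter (φ : Character H) : Prop :=
  ∀ (t : ℂ) (x : H), HasLaurentDerivAt (fun s : ℂ => minusPart (scaleChar 𝒢 s φ) x) 0 t

/-- The map `R̃(φ) = φ⁻¹ ⋆ (φ ∘ Y)`. -/
def rTilde (φ : Character H) : ConvMap H Laurent :=
  (φ⁻¹).toConvMap * WithConv.toConv (φ.ofConv.toLinearMap ∘ₗ gradingY 𝒢)

/-- `B` is the beta character `β̃_φ`, i.e. `B(x) = d/dt|_{t = 0} (φ⁻¹ ⋆ φ ^ t)(x)`. -/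
def IsBetaCharacter (φ : Character H) (B : ConvMap H Laurent) : Prop :=
  ∀ x : H, HasLaurentDerivAt (fun t : ℂ => (φ⁻¹ * scaleChar 𝒢 t φ) x) (B x) 0

/-- The beta function `β_φ = - Res(φ₋) ∘ Y`. -/
def betaFunction (φ : Character H) : ConvMap H ℂ :=
  WithConv.toConv (-((residue (minusPart φ).toConvMap).ofConv ∘ₗ gradingY 𝒢))

/-- `L` is a flow in `𝔤_𝒜` that solves the Lax pair equation
`dL/dt = [L, M]`, `M = R(λ ^ k L)`, with initial condition `L(0) = L₀`. -/
structure IsLaxFlow (k : ℤ) (L₀ : ConvMap H Laurent) (L : ℝ → ConvMap H Laurent) : Prop where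
  init : L 0 = L₀
  infinitesimal : ∀ t, IsInfinitesimalCharacter (L t)
  equation : ∀ (t : ℝ) (x : H),
    HasLaurentDerivAt (fun s : ℝ => L s x) (⁅L t, rOp (mulLam k (L t))⁆ x) t

end Hopf

end

/-! Put k = -n + 2m. In a connected graded Hopf algebra, convolution is triangular in the degree: Δx
= x ⊗ 1 plus tensors whose left factors have smaller degree. Recursions on the degree therefore both
construct and determine maps. This gives the Birkhoff decomposition (`exists_isBirkhoff`,
`IsBirkhoff.unique`), the bijectivity of R̃ onto infinitesimal characters (`exists_rTilde_eq`,
`rTilde_injective`), and the Lax flow with its uniqueness (`isLaxFlow_laxFlow`, `IsLaxFlow.unique`):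
infinitesimal characters vanish on 1, so the bracket in degree d sees only lower degrees.

Locality of φ means that β̃_φ = λR̃(φ) is holomorphic (`isLocalCharacter_iff`). The flow preserves
this: R = 2P₊ - id and L commutes with λ^k L, so [L, M] = 2[L, P₊(λ^k L)], a bracket with a
holomorphic map. If k ≥ 1, then λ^k L(0) is itself holomorphic, the bracket vanishes and the flow is
constant (`isLaxFlow_const`).

For the beta function, composing φ₊ = φ₋ ⋆ φ with the derivation Y and taking residues gives β_φ =
Ad(φ₊(0)) Res R̃(φ) (`betaFunction_eq_adScalar`). The residue of the Lax equation is X' = 2[X,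
Res(λ^(k-2) β̃)] with X = Res L (`residue_lie_laxOp`). Differentiating β = g X g⁻¹ with g = φ₊(0)
yields the claim (`conj_derivative_eq`, `hasDerivAt_betaFunction`). That g is differentiable follows
because, at each element of H, all maps involved are polynomial in t (`isPolyCurve_plusPart`). -/

noncomputable section

/-! ### Coefficients of Laurent series and the splitting into pole and holomorphic parts -/

namespace Laurent

theorem ext {a b : Laurent} (h : ∀ j, a.coeff j = b.coeff j) : a = b :=
  HahnSeries.ext (funext h)

@[simp] theorem coeff_zero (j : ℤ) : (0 : Laurent).coeff j = 0 := rfl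

@[simp] theorem coeff_add (a b : Laurent) (j : ℤ) : (a + b).coeff j = a.coeff j + b.coeff j := rfl

@[simp] theorem coeff_sub (a b : Laurent) (j : ℤ) : (a - b).coeff j = a.coeff j - b.coeff j := rfl

@[simp] theorem coeff_neg (a : Laurent) (j : ℤ) : (-a).coeff j = -a.coeff j := rfl

@[simp] theorem coeff_smul (c : ℂ) (a : Laurent) (j : ℤ) : (c • a).coeff j = c * a.coeff j := rfl

@[simp] theorem coeff_sum {ι : Type*} (s : Finset ι) (f : ι → Laurent) (j : ℤ) :
    (∑ i ∈ s, f i).coeff j = ∑ i ∈ s, (f i).coeff j :=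
  map_sum (coeffLin j) f s

theorem coeff_algebraMap (c : ℂ) (j : ℤ) :
    (algebraMap ℂ Laurent c).coeff j = if j = 0 then c else 0 := by
  have h : algebraMap ℂ Laurent c = (HahnSeries.C c : HahnSeries ℤ ℂ) :=
    HahnSeries.algebraMap_apply
  rw [h]
  change HahnSeries.coeff (HahnSeries.single (0 : ℤ) c) j = _
  rw [HahnSeries.coeff_single]
  congr

theorem coeff_lam_mul (k : ℤ) (a : Laurent) (j : ℤ) : (lam k * a).coeff j = a.coeff (j - k) := by
  have h := HahnSeries.coeff_single_mul_add (r := (1 : ℂ)) (x := (show HahnSeries ℤ ℂ from a))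
    (a := j - k) (b := k)
  rw [sub_add_cancel, one_mul] at h
  exact h

/-- Frees the product formula from the supports of the factors: any finite set of exponents
containing all nonzero contributions serves as index set, and `T` may then be chosen empty, a
singleton or a range. -/
theorem coeff_mul_eq_sum {a b : Laurent} {n : ℤ} (T : Finset ℤ)
    (h : ∀ i ∉ T, a.coeff i * b.coeff (n - i) = 0) :
    (a * b).coeff n = ∑ i ∈ T, a.coeff i * b.coeff (n - i) := by
  refine (HahnSeries.coeff_mul (x := (show HahnSeries ℤ ℂ from a))
    (y := (show HahnSeries ℤ ℂ from b)) (a := n)).trans ?_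
  have hmem : ∀ ij : ℤ × ℤ, ij ∈ Finset.antidiagonal (HahnSeries.isPWO_support
      (show HahnSeries ℤ ℂ from a)) (HahnSeries.isPWO_support (show HahnSeries ℤ ℂ from b)) n ↔
      a.coeff ij.1 ≠ 0 ∧ b.coeff ij.2 ≠ 0 ∧ ij.1 + ij.2 = n := fun ij => Finset.mem_antidiagonal
  refine Finset.sum_bij_ne_zero (fun ij _ _ => ij.1) ?_ ?_ ?_ ?_
  · intro ij hij _
    obtain ⟨h₁, h₂, h₃⟩ := (hmem ij).1 hij
    by_contra hT
    refine mul_ne_zero h₁ h₂ ?_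
    rw [← h _ hT, ← h₃, add_sub_cancel_left]
  · intro x hx _ y hy _ hxy
    have h₁ := ((hmem x).1 hx).2.2
    have h₂ := ((hmem y).1 hy).2.2
    exact Prod.ext hxy (by omega)
  · intro i _ hi
    refine ⟨(i, n - i), (hmem _).2 ⟨left_ne_zero_of_mul hi, right_ne_zero_of_mul hi, by simp⟩,
      hi, rfl⟩
  · intro ij hij _
    have h₃ := ((hmem ij).1 hij).2.2
    change a.coeff ij.1 * b.coeff ij.2 = _
    rw [← h₃, add_sub_cancel_left]

theorem coeff_mul_eq_zero {a b : Laurent} {n : ℤ}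
    (h : ∀ i j, i + j = n → a.coeff i * b.coeff j = 0) : (a * b).coeff n = 0 :=
  coeff_mul_eq_sum ∅ fun i _ => h i (n - i) (by simp)

/-- Serves for extreme coefficients, lowest or highest, where only one pair of exponents can
contribute. -/
theorem coeff_mul_eq_single {a b : Laurent} {i₀ j₀ : ℤ}
    (h : ∀ i j, i + j = i₀ + j₀ → i ≠ i₀ → a.coeff i * b.coeff j = 0) :
    (a * b).coeff (i₀ + j₀) = a.coeff i₀ * b.coeff j₀ := by
  rw [coeff_mul_eq_sum {i₀} fun i hi => h i _ (by simp) (by simpa using hi)]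
  simp

theorem coeff_projMinus (a : Laurent) (j : ℤ) :
    (projMinus a).coeff j = if j < 0 then a.coeff j else 0 :=
  HahnSeries.coeff_truncLT _ _ _

theorem coeff_projPlus (a : Laurent) (j : ℤ) :
    (projPlus a).coeff j = if j < 0 then 0 else a.coeff j := by
  change a.coeff j - (projMinus a).coeff j = _
  rw [coeff_projMinus]; split_ifs <;> simp

theorem projMinus_add_projPlus (a : Laurent) : projMinus a + projPlus a = a := by
  simp [projPlus]

theorem projMinus_eq_zero_iff {a : Laurent} : projMinus a = 0 ↔ ∀ j < 0, a.coeff j = 0 := by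
  constructor
  · intro h j hj
    have := coeff_projMinus a j
    rw [h, if_pos hj] at this
    exact this.symm
  · intro h
    refine ext fun j => ?_
    rw [coeff_projMinus]
    split_ifs with hj
    · simp [h j hj]
    · rfl

theorem projPlus_eq_zero_iff {a : Laurent} : projPlus a = 0 ↔ ∀ j, 0 ≤ j → a.coeff j = 0 := by
  constructor
  · intro h j hj
    have := coeff_projPlus a j
    rw [h, if_neg (not_lt.2 hj)] at this
    exact this.symm
  · intro h
    refine ext fun j => ?_
    rw [coeff_projPlus]
    split_ifs with hj
    · rfl
    · simp [h j (not_lt.1 hj)]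

/-- The subalgebra `ℂ[[λ]]` of holomorphic Laurent series. -/
def holomorphic : Subalgebra ℂ Laurent where
  carrier := {a | projMinus a = 0}
  mul_mem' := by
    intro a b ha hb
    rw [Set.mem_ofPred_eq, projMinus_eq_zero_iff] at *
    intro j hj
    refine coeff_mul_eq_zero fun i i' h => ?_
    rcases lt_or_ge i 0 with hi | hi
    · rw [ha i hi, zero_mul]
    · rw [hb i' (by omega), mul_zero]
  add_mem' := by
    intro a b ha hb
    rw [Set.mem_ofPred_eq] at *
    rw [map_add, ha, hb, add_zero]
  algebraMap_mem' c := by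
    rw [Set.mem_ofPred_eq, projMinus_eq_zero_iff]
    intro j hj
    rw [coeff_algebraMap, if_neg hj.ne]

theorem mem_holomorphic_iff_projMinus {a : Laurent} : a ∈ holomorphic ↔ projMinus a = 0 := Iff.rfl

theorem mem_holomorphic_iff {a : Laurent} : a ∈ holomorphic ↔ ∀ j < 0, a.coeff j = 0 :=
  projMinus_eq_zero_iff

theorem projPlus_mem_holomorphic (a : Laurent) : projPlus a ∈ holomorphic := by
  rw [mem_holomorphic_iff]
  intro j hj
  rw [coeff_projPlus, if_pos hj]

theorem projPlus_projMinus (a : Laurent) : projPlus (projMinus a) = 0 := by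
  rw [projPlus_eq_zero_iff]
  intro j hj
  rw [coeff_projMinus, if_neg (not_lt.2 hj)]

theorem lam_mem_holomorphic {k : ℤ} (hk : 0 ≤ k) : lam k ∈ holomorphic := by
  rw [mem_holomorphic_iff]
  intro j hj
  rw [← mul_one (lam k), coeff_lam_mul, ← map_one (algebraMap ℂ Laurent), coeff_algebraMap,
    if_neg (by omega)]

/-- Taking the constant term is multiplicative on holomorphic series. -/
theorem coeff_zero_mul {a b : Laurent} (ha : a ∈ holomorphic) (hb : b ∈ holomorphic) :
    (a * b).coeff 0 = a.coeff 0 * b.coeff 0 := by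
  rw [mem_holomorphic_iff] at ha hb
  refine coeff_mul_eq_single (i₀ := 0) (j₀ := 0) fun i j h hi => ?_
  rcases lt_or_gt_of_ne hi with hi | hi
  · rw [ha i hi, zero_mul]
  · rw [hb j (by omega), mul_zero]

/-- The pole part `λ⁻¹ ℂ[λ⁻¹]` is closed under multiplication. -/
theorem projPlus_mul_eq_zero {a b : Laurent} (ha : projPlus a = 0) (hb : projPlus b = 0) :
    projPlus (a * b) = 0 := by
  rw [projPlus_eq_zero_iff] at *
  intro n hn
  refine coeff_mul_eq_zero fun i j h => ?_
  rcases lt_or_ge i 0 with hi | hi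
  · rw [hb j (by omega), mul_zero]
  · rw [ha i hi, zero_mul]

theorem eq_zero_of_projPlus {a : Laurent} (ha : a ∈ holomorphic) (hb : projPlus a = 0) : a = 0 := by
  rw [← projMinus_add_projPlus a, hb, mem_holomorphic_iff_projMinus.1 ha, add_zero]

theorem exists_coeff_eq_zero (a : Laurent) : ∃ M : ℤ, ∀ j < M, a.coeff j = 0 := by
  refine ⟨HahnSeries.order (show HahnSeries ℤ ℂ from a), fun j hj => ?_⟩
  exact HahnSeries.coeff_eq_zero_of_lt_order hj

theorem coeff_expLam (c : ℂ) (n : ℕ) : (expLam c).coeff n = c ^ n / n.factorial := by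
  have h := HahnSeries.ofPowerSeries_apply_coeff (Γ := ℤ)
    (PowerSeries.rescale c (PowerSeries.exp ℂ)) n
  refine h.trans ?_
  rw [PowerSeries.coeff_rescale, PowerSeries.coeff_exp]
  simp [div_eq_mul_inv]

theorem coeff_expLam_of_neg (c : ℂ) {j : ℤ} (hj : j < 0) : (expLam c).coeff j = 0 := by
  refine HahnSeries.embDomain_of_notMem_range ?_
  rintro ⟨n, hn⟩
  have : (n : ℤ) = j := hn
  omega

/-- Expansion of the coefficients of `e ^ (c λ) a` in powers of `c`. -/
theorem exists_coeff_expLam_mul (a : Laurent) (j : ℤ) : ∃ N₀ : ℕ, ∀ N ≥ N₀, ∀ c : ℂ,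
    (expLam c * a).coeff j =
      ∑ n ∈ Finset.range N, c ^ n / n.factorial * (lam n * a).coeff j := by
  obtain ⟨M, hM⟩ := exists_coeff_eq_zero a
  -- As `a` has no terms below `λ ^ M`, the coefficient of index `j - n` vanishes once `n > j - M`.
  -- The bound does not involve `c`.
  refine ⟨(j - M + 1).toNat, fun N hN c => ?_⟩
  rw [coeff_mul_eq_sum ((Finset.range N).map ⟨fun n : ℕ => (n : ℤ), Nat.cast_injective⟩)]
  · rw [Finset.sum_map]
    refine Finset.sum_congr rfl fun n _ => ?_
    rw [coeff_lam_mul]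
    exact congrArg (· * _) (coeff_expLam c n)
  · intro i hi
    rcases lt_or_ge i 0 with h0 | h0
    · rw [coeff_expLam_of_neg c h0, zero_mul]
    · lift i to ℕ using h0
      have hi' : ¬ i < N := fun h => hi (by simp [h])
      rw [hM _ (by omega), mul_zero]

end Laurent

/-! ### Homogeneous expansions of the coproduct and triangular recursion -/

open Coalgebra

section Graded
variable {H : Type*} [CommRing H] [HopfAlgebra ℂ H] (𝒢 : ℕ → Submodule ℂ H)

/-- Pairs of homogeneous elements, together with their degrees. -/
abbrev HomogeneousPair : Type _ := Σ p : ℕ × ℕ, 𝒢 p.1 × 𝒢 p.2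

variable {𝒢}

/-- The pure tensor of a pair of homogeneous elements. -/
def HomogeneousPair.tmul (i : HomogeneousPair 𝒢) : H ⊗[ℂ] H := (i.2.1 : H) ⊗ₜ[ℂ] (i.2.2 : H)

theorem ConvMap.mul_apply_eq {A : Type*} [CommRing A] [Algebra ℂ A] (f g : ConvMap H A) {x : H}
    {z : H ⊗[ℂ] H} (hz : comul (R := ℂ) x = z) :
    (f * g) x = LinearMap.mul' ℂ A (TensorProduct.map f.ofConv g.ofConv z) := by
  rw [← hz]; rfl

section
variable {A : Type*} [CommRing A] [Algebra ℂ A] (f g : ConvMap H A)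

theorem ConvMap.mul_apply_of_comul {s : Finset (HomogeneousPair 𝒢)} {x : H}
    (h : comul (R := ℂ) x = ∑ i ∈ s, i.tmul) :
    (f * g) x = ∑ i ∈ s, f i.2.1 * g i.2.2 := by
  rw [ConvMap.mul_apply_eq f g h]
  simp [HomogeneousPair.tmul]

theorem ConvMap.mul_apply_of_comul_add {s : Finset (HomogeneousPair 𝒢)} {x : H}
    (h : comul (R := ℂ) x = x ⊗ₜ[ℂ] 1 + ∑ i ∈ s, i.tmul) :
    (f * g) x = f x * g 1 + ∑ i ∈ s, f i.2.1 * g i.2.2 := by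
  rw [ConvMap.mul_apply_eq f g h]
  simp [HomogeneousPair.tmul]

/-- Multiplicativity of Δ, with the top term `f (x * y)` isolated so that inductions on the total
degree apply to the other three groups of terms. -/
theorem ConvMap.mul_apply_mul_of_comul_add {s t : Finset (HomogeneousPair 𝒢)} {x y : H}
    (hx : comul (R := ℂ) x = x ⊗ₜ[ℂ] 1 + ∑ i ∈ s, i.tmul)
    (hy : comul (R := ℂ) y = y ⊗ₜ[ℂ] 1 + ∑ i ∈ t, i.tmul) :
    (f * g) (x * y) = f (x * y) * g 1 + ∑ j ∈ t, f (x * j.2.1) * g j.2.2 +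
      (∑ i ∈ s, f (i.2.1 * y) * g i.2.2 +
        ∑ i ∈ s, ∑ j ∈ t, f (i.2.1 * j.2.1) * g (i.2.2 * j.2.2)) := by
  rw [ConvMap.mul_apply_eq f g (Bialgebra.comul_mul x y), hx, hy, add_mul, mul_add, mul_add,
    Finset.sum_mul_sum, Finset.mul_sum, Finset.sum_mul]
  simp [HomogeneousPair.tmul]

end

variable [GradedAlgebra 𝒢]

theorem IsConnectedGradedHopf.exists_comul_eq_sum (h𝒢 : IsConnectedGradedHopf 𝒢) {n : ℕ} {x : H}
    (hx : x ∈ 𝒢 n) : ∃ s : Finset (HomogeneousPair 𝒢), (∀ i ∈ s, i.1.1 + i.1.2 = n) ∧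
      comul (R := ℂ) x = ∑ i ∈ s, i.tmul := by
  classical
  obtain ⟨μ, hsum⟩ := (Submodule.mem_iSup_finset_iff_exists_sum _ _).1 (h𝒢.comul_mem n x hx)
  have hμ : ∀ p : ℕ × ℕ, ∃ S : Finset (𝒢 p.1 × 𝒢 p.2),
      (μ p : H ⊗[ℂ] H) = ∑ j ∈ S, (j.1 : H) ⊗ₜ[ℂ] (j.2 : H) := by
    intro p
    obtain ⟨w, hw⟩ := (μ p).2
    obtain ⟨S, hS⟩ := TensorProduct.exists_finset w
    exact ⟨S, by rw [← hw, hS]; simp⟩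
  choose S hS using hμ
  refine ⟨(Finset.HasAntidiagonal.antidiagonal n).sigma S, fun i hi => ?_, ?_⟩
  · exact Finset.HasAntidiagonal.mem_antidiagonal.1 (Finset.mem_sigma.1 hi).1
  · rw [← hsum, Finset.sum_sigma]
    exact Finset.sum_congr rfl fun p _ => hS p

theorem IsConnectedGradedHopf.eq_smul_one (h𝒢 : IsConnectedGradedHopf 𝒢) {x : H}
    (hx : x ∈ 𝒢 0) : x = counit (R := ℂ) x • (1 : H) := by
  rw [h𝒢.connected, Submodule.mem_span_singleton] at hx
  obtain ⟨c, rfl⟩ := hx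
  simp

/-- In a connected graded Hopf algebra `Δ x = x ⊗ 1 + ∑ a_i ⊗ b_i` with `b_i` of positive
degree. -/
theorem IsConnectedGradedHopf.exists_comul_eq_add (h𝒢 : IsConnectedGradedHopf 𝒢) {n : ℕ} {x : H}
    (hx : x ∈ 𝒢 n) : ∃ s : Finset (HomogeneousPair 𝒢), (∀ i ∈ s, i.1.1 + i.1.2 = n ∧ 0 < i.1.2) ∧
      comul (R := ℂ) x = x ⊗ₜ[ℂ] 1 + ∑ i ∈ s, i.tmul := by
  classical
  obtain ⟨s, hs, hsum⟩ := h𝒢.exists_comul_eq_sum hx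
  refine ⟨s.filter fun i => 0 < i.1.2, fun i hi => ?_, ?_⟩
  · rw [Finset.mem_filter] at hi
    exact ⟨hs i hi.1, hi.2⟩
  -- The counit axiom shows that the terms whose right factor has degree 0, hence is a scalar, add
  -- up to `x ⊗ 1`.
  · have h1 : ∑ i ∈ s, (counit (R := ℂ) (i.2.2 : H)) • (i.2.1 : H) = x := by
      have := congrArg (TensorProduct.rid ℂ H) (Coalgebra.lTensor_counit_comul (R := ℂ) x)
      rw [hsum] at this
      simpa [HomogeneousPair.tmul] using this
    rw [hsum, ← Finset.sum_filter_add_sum_filter_not s (fun i => 0 < i.1.2), add_comm]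
    congr 1
    conv_rhs => rw [← h1]
    rw [TensorProduct.sum_tmul, Finset.sum_filter]
    refine Finset.sum_congr rfl fun i _ => ?_
    split_ifs with h
    · rw [h𝒢.counit_eq_zero i.1.2 h.ne' _ i.2.2.2, zero_smul, TensorProduct.zero_tmul]
    · rw [TensorProduct.smul_tmul, ← h𝒢.eq_smul_one]
      · rfl
      · exact (congrArg 𝒢 (Nat.eq_zero_of_not_pos h)).le i.2.2.2

theorem ConvMap.ext_homogeneous {A : Type*} [AddCommGroup A] [Module ℂ A] {f g : WithConv (H →ₗ[ℂ] A)}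
    (h : ∀ n, ∀ x ∈ 𝒢 n, f x = g x) : f = g := by
  refine WithConv.ext (LinearMap.ext fun x => ?_)
  induction x using DirectSum.Decomposition.inductionOn 𝒢 with
  | zero => simp
  | homogeneous m => exact h _ _ m.2
  | add x y hx hy => rw [map_add, map_add, hx, hy]

/-- An operator whose values in degree `d` depend only on values in lower degrees has a fixed
point. -/
theorem exists_fixedPoint_of_triangular {A : Type*} [AddCommGroup A] [Module ℂ A]
    (T : WithConv (H →ₗ[ℂ] A) → WithConv (H →ₗ[ℂ] A))
    (hT : ∀ d f g, (∀ e < d, ∀ x ∈ 𝒢 e, f x = g x) → ∀ x ∈ 𝒢 d, T f x = T g x) :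
    ∃ f, T f = f := by
  -- Each application of `T` settles one more degree, so degree `d` is final after `d + 1`
  -- iterations from 0; `F` glues these final values.
  have hstab : ∀ n d, d < n → ∀ x ∈ 𝒢 d, T^[n] 0 x = T^[n + 1] 0 x := by
    intro n
    induction n with
    | zero => intro d hd; omega
    | succ n ih =>
      intro d hd
      rw [Function.iterate_succ_apply' T n, Function.iterate_succ_apply' T (n + 1)]
      exact hT d _ _ fun e he => ih e (by omega)
  have hstab' : ∀ n d, d < n → ∀ x ∈ 𝒢 d, T^[n] 0 x = T^[d + 1] 0 x := by
    intro n d hd x hx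
    induction n, hd using Nat.le_induction with
    | base => rfl
    | succ n hn ih => rw [← hstab n d hn x hx, ih]
  let F : H →ₗ[ℂ] A := (DirectSum.toModule ℂ ℕ A fun n => (T^[n + 1] 0).ofConv ∘ₗ (𝒢 n).subtype) ∘ₗ
    (DirectSum.decomposeLinearEquiv 𝒢).toLinearMap
  have hF : ∀ n, ∀ x ∈ 𝒢 n, F x = T^[n + 1] 0 x := by
    intro n x hx
    lift x to 𝒢 n using hx
    simp [F]
  refine ⟨WithConv.toConv F, ConvMap.ext_homogeneous (𝒢 := 𝒢) fun n x hx => ?_⟩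
  refine Eq.trans ?_ (hF n x hx).symm
  rw [Function.iterate_succ_apply']
  exact hT n _ _ (fun e he y hy => (hF e y hy).trans (hstab' n e he y hy).symm) x hx

end Graded

/-! ### Series in ℂ[λ⁻¹] -/

namespace Laurent

/-- The subalgebra `ℂ[λ⁻¹]` of Laurent series without terms of positive degree. -/
def polar : Subalgebra ℂ Laurent where
  carrier := {a | ∀ j > 0, a.coeff j = 0}
  mul_mem' := by
    intro a b ha hb j hj
    refine coeff_mul_eq_zero fun i i' h => ?_
    rcases lt_or_ge 0 i with hi | hi
    · rw [ha i hi, zero_mul]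
    · rw [hb i' (by omega), mul_zero]
  add_mem' := by
    intro a b ha hb j hj
    rw [coeff_add, ha j hj, hb j hj, add_zero]
  algebraMap_mem' c := by
    intro j hj
    rw [coeff_algebraMap, if_neg (ne_of_gt hj)]

theorem mem_polar_iff {a : Laurent} : a ∈ polar ↔ ∀ j > 0, a.coeff j = 0 := Iff.rfl

theorem coeff_zero_mul_of_mem_polar {a b : Laurent} (ha : a ∈ polar) (hb : b ∈ polar) :
    (a * b).coeff 0 = a.coeff 0 * b.coeff 0 := by
  rw [mem_polar_iff] at ha hb
  refine coeff_mul_eq_single (i₀ := 0) (j₀ := 0) fun i j h hi => ?_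
  rcases lt_or_gt_of_ne hi with hi | hi
  · rw [hb j (by omega), mul_zero]
  · rw [ha i hi, zero_mul]

theorem mem_polar_of_projPlus {a : Laurent} (ha : projPlus a = 0) : a ∈ polar :=
  fun j hj => projPlus_eq_zero_iff.1 ha j hj.le

theorem projPlus_eq_zero_iff_mem_polar {a : Laurent} :
    projPlus a = 0 ↔ a ∈ polar ∧ a.coeff 0 = 0 := by
  refine ⟨fun h => ⟨mem_polar_of_projPlus h, projPlus_eq_zero_iff.1 h 0 le_rfl⟩, fun h => ?_⟩
  rw [projPlus_eq_zero_iff]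
  intro j hj
  rcases hj.lt_or_eq with hj | rfl
  · exact h.1 j hj
  · exact h.2

/-- The exponents of `a` are at most -1 and those of `b` at most 0, so a total of -1 is reached in
one way only. -/
theorem coeff_neg_one_mul_of_mem_polar {a b : Laurent} (ha : projPlus a = 0) (hb : b ∈ polar) :
    (a * b).coeff (-1) = a.coeff (-1) * b.coeff 0 := by
  rw [projPlus_eq_zero_iff] at ha
  refine coeff_mul_eq_single (i₀ := -1) (j₀ := 0) fun i j h hi => ?_
  rcases lt_or_gt_of_ne hi with hi | hi
  · rw [hb j (by omega), mul_zero]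
  · rw [ha i (by omega), zero_mul]

theorem eq_algebraMap_of_mem {a : Laurent} (ha : a ∈ holomorphic) (hb : a ∈ polar) :
    a = algebraMap ℂ Laurent (a.coeff 0) := by
  refine ext fun j => ?_
  rw [coeff_algebraMap]
  split_ifs with h
  · rw [h]
  · rcases lt_or_gt_of_ne h with h | h
    · exact mem_holomorphic_iff.1 ha j h
    · exact hb j h

end Laurent

/-! ### Existence and uniqueness of the Birkhoff decomposition -/

open Laurent

section Hopf
variable {H : Type*} [CommRing H] [HopfAlgebra ℂ H]

@[simp] theorem Character.toConvMap_apply (φ : Character H) (x : H) : φ.toConvMap x = φ x := rfl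

theorem Character.toConvMap_mul (φ ψ : Character H) :
    (φ * ψ).toConvMap = φ.toConvMap * ψ.toConvMap := rfl

theorem Character.toConvMap_one : (1 : Character H).toConvMap = 1 := rfl

theorem Character.toConvMap_inv_mul (φ : Character H) :
    (φ⁻¹).toConvMap * φ.toConvMap = 1 := by
  rw [← Character.toConvMap_mul, inv_mul_cancel, Character.toConvMap_one]

theorem Character.toConvMap_mul_inv (φ : Character H) :
    φ.toConvMap * (φ⁻¹).toConvMap = 1 := by
  rw [← Character.toConvMap_mul, mul_inv_cancel, Character.toConvMap_one]

theorem Character.ext' {φ ψ : Character H} (h : ∀ x, φ x = ψ x) : φ = ψ :=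
  WithConv.ext (AlgHom.ext h)

theorem Character.toConvMap_injective :
    Function.Injective (Character.toConvMap : Character H → ConvMap H Laurent) := fun _ _ h =>
  Character.ext' fun x => congrArg (fun f : ConvMap H Laurent => f x) h

theorem ConvMap.mul_mem (𝒮 : Subalgebra ℂ Laurent) {f g : ConvMap H Laurent}
    (hf : ∀ x, f x ∈ 𝒮) (hg : ∀ x, g x ∈ 𝒮) (x : H) : (f * g) x ∈ 𝒮 := by
  rw [(Coalgebra.Repr.arbitrary ℂ x).convMul_apply]
  exact sum_mem fun i _ => Subalgebra.mul_mem _ (hf _) (hg _)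

/-- The hypothesis is kept abstract because the constant term is multiplicative on two different
subalgebras, `holomorphic` and `polar`. -/
theorem atZero_mul {f g : ConvMap H Laurent}
    (h : ∀ x y, (f x * g y).coeff 0 = (f x).coeff 0 * (g y).coeff 0) :
    atZero (f * g) = atZero f * atZero g := by
  refine WithConv.ext (LinearMap.ext fun x => ?_)
  refine Eq.trans ?_ ((Coalgebra.Repr.arbitrary ℂ x).convMul_apply (atZero f) (atZero g)).symm
  change ((f * g) x).coeff 0 = _
  rw [(Coalgebra.Repr.arbitrary ℂ x).convMul_apply, coeff_sum]
  exact Finset.sum_congr rfl fun i _ => h _ _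

theorem atZero_mul_of_holomorphic {f g : ConvMap H Laurent} (hf : ∀ x, f x ∈ holomorphic)
    (hg : ∀ x, g x ∈ holomorphic) : atZero (f * g) = atZero f * atZero g :=
  atZero_mul fun x y => coeff_zero_mul (hf x) (hg y)

theorem atZero_one : atZero (1 : ConvMap H Laurent) = 1 := by
  refine WithConv.ext (LinearMap.ext fun x => ?_)
  change (algebraMap ℂ Laurent (counit (R := ℂ) x)).coeff 0 = _
  rw [coeff_algebraMap, if_pos rfl]
  rfl

/-- The condition on `φ₋` in a Birkhoff decomposition: values in `ℂ[λ⁻¹]`, with constant term the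
counit. -/
theorem minus_iff {u : Character H} :
    (∀ x : H, counit (R := ℂ) x = 0 → projPlus (u x) = 0) ↔
      (∀ x, u x ∈ polar) ∧ atZero u.toConvMap = 1 := by
  constructor
  · intro h
    have key : ∀ x, projPlus (u x - algebraMap ℂ Laurent (counit (R := ℂ) x)) = 0 := by
      intro x
      have := h (x - algebraMap ℂ H (counit (R := ℂ) x)) (by simp)
      rwa [map_sub, AlgHom.commutes] at this
    refine ⟨fun x => ?_, WithConv.ext (LinearMap.ext fun x => ?_)⟩
    · have := add_mem (mem_polar_of_projPlus (key x))
        (algebraMap_mem polar (counit (R := ℂ) x))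
      rwa [sub_add_cancel] at this
    · have := projPlus_eq_zero_iff.1 (key x) 0 le_rfl
      rw [coeff_sub, coeff_algebraMap, if_pos rfl, sub_eq_zero] at this
      exact this
  · rintro ⟨h₁, h₂⟩ x hx
    rw [projPlus_eq_zero_iff_mem_polar]
    refine ⟨h₁ x, ?_⟩
    have := congrArg (fun f : ConvMap H ℂ => f x) h₂
    refine Eq.trans this ?_
    rw [LinearMap.convOne_apply, hx, map_zero]

theorem atZero_inv (u : Character H) :
    atZero (u⁻¹).toConvMap = scalarInv (atZero u.toConvMap) := rfl

theorem scalarInv_one : scalarInv (1 : ConvMap H ℂ) = 1 := by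
  refine WithConv.ext (LinearMap.ext fun x => ?_)
  change (counit (R := ℂ) (HopfAlgebra.antipode ℂ x)) = _
  simp

theorem IsBirkhoff.polar_minus {φ : Character H} {p : Character H × Character H}
    (h : IsBirkhoff φ p) (x : H) : p.1 x ∈ polar := (minus_iff.1 h.minus).1 x

theorem IsBirkhoff.atZero_minus {φ : Character H} {p : Character H × Character H}
    (h : IsBirkhoff φ p) : atZero p.1.toConvMap = 1 := (minus_iff.1 h.minus).2

/-- The quotient q₋ ⋆ p₋⁻¹ = q₊ ⋆ p₊⁻¹ takes values that are both polar and holomorphic, hence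
constant; the normalization of the minus factors makes that constant the counit. -/
theorem IsBirkhoff.unique {φ : Character H} {p q : Character H × Character H}
    (hp : IsBirkhoff φ p) (hq : IsBirkhoff φ q) : p = q := by
  have h : q.1 * p.1⁻¹ = q.2 * p.2⁻¹ := by
    have := hp.eq.symm.trans hq.eq
    rw [inv_mul_eq_iff_eq_mul] at this
    rw [this]
    group
  have h1 : ∀ x, (q.1 * p.1⁻¹) x ∈ polar :=
    ConvMap.mul_mem polar (f := q.1.toConvMap) (g := p.1⁻¹.toConvMap) hq.polar_minus
      fun x => hp.polar_minus _
  have h2 : ∀ x, (q.1 * p.1⁻¹) x ∈ holomorphic := by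
    rw [h]
    exact ConvMap.mul_mem holomorphic (f := q.2.toConvMap) (g := p.2⁻¹.toConvMap) hq.plus
      fun x => hp.plus _
  have h3 : atZero (q.1 * p.1⁻¹).toConvMap = 1 := by
    rw [Character.toConvMap_mul, atZero_mul, atZero_inv, hp.atZero_minus, hq.atZero_minus,
      scalarInv_one, one_mul]
    exact fun x y => coeff_zero_mul_of_mem_polar (hq.polar_minus _) (hp.polar_minus _)
  have h4 : q.1 * p.1⁻¹ = 1 := by
    refine Character.ext' fun x => ?_
    rw [eq_algebraMap_of_mem (h2 x) (h1 x)]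
    exact congrArg (fun f : ConvMap H ℂ => algebraMap ℂ Laurent (f x)) h3
  have h5 : q.2 * p.2⁻¹ = 1 := h ▸ h4
  exact Prod.ext (mul_inv_eq_one.1 h4).symm (mul_inv_eq_one.1 h5).symm

variable {𝒢 : ℕ → Submodule ℂ H} [GradedAlgebra 𝒢]

/-- A unital linear map that is multiplicative on homogeneous elements is a character. -/
def Character.ofHomogeneous (𝒢 : ℕ → Submodule ℂ H) [GradedAlgebra 𝒢] (u : ConvMap H Laurent)
    (h1 : u 1 = 1) (hmul : ∀ p q, ∀ x ∈ 𝒢 p, ∀ y ∈ 𝒢 q, u (x * y) = u x * u y) : Character H :=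
  WithConv.toConv <| AlgHom.ofLinearMap u.ofConv h1 fun x y => by
    induction x using DirectSum.Decomposition.inductionOn 𝒢 with
    | zero => simp
    | add x x' hx hx' => rw [add_mul, map_add, map_add, hx, hx', add_mul]
    | homogeneous x =>
      induction y using DirectSum.Decomposition.inductionOn 𝒢 with
      | zero => simp
      | add y y' hy hy' => rw [mul_add, map_add, map_add, hy, hy', mul_add]
      | homogeneous y => exact hmul _ _ _ x.2 _ y.2

/-- Bogoliubov's recursion as a fixed point equation. Subtracting `f` from `f * φ` cancels the top
term `f x * φ 1`, which makes the operator triangular. -/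
theorem exists_linear_birkhoff (h𝒢 : IsConnectedGradedHopf 𝒢) (φ : Character H) :
    ∃ u : ConvMap H Laurent, u 1 = 1 ∧ (∀ x, counit (R := ℂ) x = 0 → projPlus (u x) = 0) ∧
      ∀ x, (u * φ.toConvMap) x ∈ holomorphic := by
  obtain ⟨u, hu⟩ := exists_fixedPoint_of_triangular (𝒢 := 𝒢)
    (fun f : ConvMap H Laurent => 1 - ConvMap.post projMinus (f * φ.toConvMap - f)) (by
      intro d f g hfg x hx
      obtain ⟨s, hs, hsum⟩ := h𝒢.exists_comul_eq_add hx
      change algebraMap ℂ Laurent (counit (R := ℂ) x) - projMinus ((f * φ.toConvMap) x - f x) =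
        algebraMap ℂ Laurent (counit (R := ℂ) x) - projMinus ((g * φ.toConvMap) x - g x)
      rw [ConvMap.mul_apply_of_comul_add _ _ hsum, ConvMap.mul_apply_of_comul_add _ _ hsum,
        Character.toConvMap_apply, map_one, mul_one, mul_one, add_sub_cancel_left,
        add_sub_cancel_left]
      congr 2
      refine Finset.sum_congr rfl fun i hi => ?_
      rw [hfg i.1.1 (by have := hs i hi; omega) _ i.2.1.2])
  have hu' : ∀ x, u x = algebraMap ℂ Laurent (counit (R := ℂ) x) -
      projMinus ((u * φ.toConvMap) x - u x) := fun x =>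
    congrArg (fun f : ConvMap H Laurent => f x) hu.symm
  refine ⟨u, ?_, fun x hx => ?_, fun x => ?_⟩
  · rw [hu' 1, (Coalgebra.Repr.mk (R := ℂ) (a := (1 : H)) (ι := Unit) Finset.univ (fun _ => 1)
      (fun _ => 1) (by simp [Algebra.TensorProduct.one_def])).convMul_apply]
    simp
  · rw [hu' x, hx, map_zero, zero_sub, map_neg, projPlus_projMinus, neg_zero]
  · have h := hu' x
    set w := (u * φ.toConvMap) x
    have h2 : w = algebraMap ℂ Laurent (counit (R := ℂ) x) + projPlus (w - u x) := by
      have := projMinus_add_projPlus (w - u x)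
      linear_combination h - this
    rw [h2]
    exact add_mem (algebraMap_mem _ _) (projPlus_mem_holomorphic _)

/-- By induction on the total degree, the defect of multiplicativity of `u` at `(x, y)` equals that
of `u * φ`, so it is holomorphic. It is also a pure pole part, because pole parts are closed under
products. Hence it vanishes. -/
theorem linear_birkhoff_mul (h𝒢 : IsConnectedGradedHopf 𝒢) (φ : Character H)
    {u : ConvMap H Laurent} (h1 : u 1 = 1)
    (hm : ∀ x, counit (R := ℂ) x = 0 → projPlus (u x) = 0)
    (hp : ∀ x, (u * φ.toConvMap) x ∈ holomorphic) (n : ℕ) :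
    ∀ p q, p + q = n → ∀ x ∈ 𝒢 p, ∀ y ∈ 𝒢 q, u (x * y) = u x * u y := by
  induction n using Nat.strong_induction_on with
  | _ n ih =>
  intro p q hpq x hx y hy
  rcases Nat.eq_zero_or_pos p with rfl | hp0
  · rw [h𝒢.eq_smul_one hx]; simp [h1]
  rcases Nat.eq_zero_or_pos q with rfl | hq0
  · rw [h𝒢.eq_smul_one hy]; simp [h1]
  have hεx := h𝒢.counit_eq_zero p hp0.ne' x hx
  have hεy := h𝒢.counit_eq_zero q hq0.ne' y hy
  obtain ⟨s, hs, hsx⟩ := h𝒢.exists_comul_eq_add hx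
  obtain ⟨t, ht, hty⟩ := h𝒢.exists_comul_eq_add hy
  have key : u (x * y) - u x * u y =
      (u * φ.toConvMap) (x * y) - (u * φ.toConvMap) x * (u * φ.toConvMap) y := by
    rw [ConvMap.mul_apply_mul_of_comul_add _ _ hsx hty, ConvMap.mul_apply_of_comul_add _ _ hsx,
      ConvMap.mul_apply_of_comul_add _ _ hty]
    simp only [Character.toConvMap_apply, map_one, mul_one, map_mul]
    have e1 : ∑ j ∈ t, u (x * j.2.1) * φ j.2.2 = u x * ∑ j ∈ t, u j.2.1 * φ j.2.2 := by
      rw [Finset.mul_sum]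
      refine Finset.sum_congr rfl fun j hj => ?_
      have := ht j hj
      rw [ih (p + j.1.1) (by omega) _ _ rfl x hx _ j.2.1.2]
      ring
    have e2 : ∑ i ∈ s, u (i.2.1 * y) * φ i.2.2 = (∑ i ∈ s, u i.2.1 * φ i.2.2) * u y := by
      rw [Finset.sum_mul]
      refine Finset.sum_congr rfl fun i hi => ?_
      have := hs i hi
      rw [ih (i.1.1 + q) (by omega) _ _ rfl _ i.2.1.2 y hy]
      ring
    have e3 : ∑ i ∈ s, ∑ j ∈ t, u (i.2.1 * j.2.1) * (φ i.2.2 * φ j.2.2) =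
        (∑ i ∈ s, u i.2.1 * φ i.2.2) * ∑ j ∈ t, u j.2.1 * φ j.2.2 := by
      rw [Finset.sum_mul_sum]
      refine Finset.sum_congr rfl fun i hi => Finset.sum_congr rfl fun j hj => ?_
      have := hs i hi
      have := ht j hj
      rw [ih (i.1.1 + j.1.1) (by omega) _ _ rfl _ i.2.1.2 _ j.2.1.2]
      ring
    rw [e1, e2, e3]
    ring
  have hhol : u (x * y) - u x * u y ∈ holomorphic := by
    rw [key]
    exact sub_mem (hp _) (mul_mem (hp _) (hp _))
  have hpol : projPlus (u (x * y) - u x * u y) = 0 := by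
    rw [map_sub, hm (x * y) (by simp [hεx]), projPlus_mul_eq_zero (hm x hεx) (hm y hεy), sub_zero]
  exact sub_eq_zero.1 (eq_zero_of_projPlus hhol hpol)

theorem exists_isBirkhoff (h𝒢 : IsConnectedGradedHopf 𝒢) (φ : Character H) :
    ∃ p, IsBirkhoff φ p := by
  obtain ⟨u, h1, hm, hp⟩ := exists_linear_birkhoff h𝒢 φ
  let U : Character H := Character.ofHomogeneous 𝒢 u h1 fun p q =>
    linear_birkhoff_mul h𝒢 φ h1 hm hp (p + q) p q rfl
  exact ⟨(U, U * φ), ⟨by group, hm, hp⟩⟩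

theorem isBirkhoff_birkhoff (h𝒢 : IsConnectedGradedHopf 𝒢) (φ : Character H) :
    IsBirkhoff φ (minusPart φ, plusPart φ) :=
  Classical.epsilon_spec (exists_isBirkhoff h𝒢 φ)

end Hopf

/-! ### Infinitesimal characters and the bijection R̃ -/

section Hopf
variable {H : Type*} [CommRing H] [HopfAlgebra ℂ H]
variable {A : Type*} [CommRing A] [Algebra ℂ A]

theorem ConvMap.mul_apply_one (f g : ConvMap H A) : (f * g) 1 = f 1 * g 1 := by
  rw [ConvMap.mul_apply_eq f g (Bialgebra.comul_one (R := ℂ) (A := H))]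
  simp [Algebra.TensorProduct.one_def]

theorem ConvMap.mul_apply_mul {ι κ : Type*} (f g : ConvMap H A) {x y : H}
    (r : Coalgebra.Repr ℂ x ι) (t : Coalgebra.Repr ℂ y κ) :
    (f * g) (x * y) = ∑ i ∈ r.index, ∑ j ∈ t.index,
      f (r.left i * t.left j) * g (r.right i * t.right j) := by
  rw [ConvMap.mul_apply_eq f g (Bialgebra.comul_mul x y), ← r.eq, ← t.eq, Finset.sum_mul_sum]
  simp

theorem ConvMap.ext_apply {f g : ConvMap H A} (h : ∀ x, f x = g x) : f = g :=
  WithConv.ext (LinearMap.ext h)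

namespace IsInfinitesimalCharacter

theorem map_one {Z : ConvMap H A} (hZ : IsInfinitesimalCharacter Z) : Z 1 = 0 := by
  have h := hZ 1 1
  simp only [mul_one, Bialgebra.counit_one, _root_.map_one, one_mul] at h
  simpa using h

theorem post {Z : ConvMap H Laurent} (hZ : IsInfinitesimalCharacter Z) (p : Laurent →ₗ[ℂ] A) :
    IsInfinitesimalCharacter (ConvMap.post p Z) := by
  intro x y
  change p (Z (x * y)) = p (Z x) * _ + _ * p (Z y)
  rw [hZ x y, mul_comm (Z x), ← Algebra.smul_def, ← Algebra.smul_def, mul_comm (p _),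
    ← Algebra.smul_def, ← Algebra.smul_def, map_add, map_smul, map_smul]

theorem sum {ι : Type*} {s : Finset ι} {Z : ι → ConvMap H A}
    (hZ : ∀ i ∈ s, IsInfinitesimalCharacter (Z i)) : IsInfinitesimalCharacter (∑ i ∈ s, Z i) := by
  have happ : ∀ x, (∑ i ∈ s, Z i) x = ∑ i ∈ s, Z i x := fun x =>
    (congrArg (fun f : H →ₗ[ℂ] A => f x) (WithConv.ofConv_sum s Z)).trans
      (LinearMap.sum_apply _ _ _)
  intro x y
  rw [happ, happ, happ, Finset.sum_mul, Finset.mul_sum, ← Finset.sum_add_distrib]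
  exact Finset.sum_congr rfl fun i hi => hZ i hi x y

theorem smul {Z : ConvMap H A} (hZ : IsInfinitesimalCharacter Z) (c : ℂ) :
    IsInfinitesimalCharacter (c • Z) := by
  intro x y
  change c • Z (x * y) = c • Z x * _ + _ * c • Z y
  rw [hZ x y, smul_add, smul_mul_assoc, mul_smul_comm]

theorem lie {Z W : ConvMap H A} (hZ : IsInfinitesimalCharacter Z)
    (hW : IsInfinitesimalCharacter W) : IsInfinitesimalCharacter ⁅Z, W⁆ := by
  -- The cross terms `Z x * W y + W x * Z y` are symmetric in `Z` and `W`, so they cancel in the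
  -- commutator.
  have key : ∀ {Z W : ConvMap H A}, IsInfinitesimalCharacter Z → IsInfinitesimalCharacter W →
      ∀ x y, (Z * W) (x * y) = (Z * W) x * algebraMap ℂ A (counit (R := ℂ) y) + Z x * W y +
        (W x * Z y + algebraMap ℂ A (counit (R := ℂ) x) * (Z * W) y) := by
    intro Z W hZ hW x y
    set r := Coalgebra.Repr.arbitrary ℂ x
    set t := Coalgebra.Repr.arbitrary ℂ y
    have e : ∀ f g : ConvMap H A, ∀ f' g' : ConvMap H A,
        ∑ i ∈ r.index, ∑ j ∈ t.index, (f (r.left i) * g (r.right i)) *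
          (f' (t.left j) * g' (t.right j)) = (f * g) x * (f' * g') y := by
      intro f g f' g'
      rw [r.convMul_apply, t.convMul_apply, Finset.sum_mul_sum]
    have e1 := e Z W 1 1
    have e2 := e Z 1 1 W
    have e3 := e 1 W Z 1
    have e4 := e 1 1 Z W
    simp only [mul_one, one_mul] at e1 e2 e3 e4
    change _ = _ * algebraMap ℂ A (counit (R := ℂ) y) at e1
    change _ = algebraMap ℂ A (counit (R := ℂ) x) * _ at e4
    rw [ConvMap.mul_apply_mul Z W r t, ← e1, ← e2, ← e3, ← e4]
    simp only [← Finset.sum_add_distrib]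
    refine Finset.sum_congr rfl fun i _ => Finset.sum_congr rfl fun j _ => ?_
    rw [hZ, hW]
    simp only [LinearMap.convOne_apply]
    ring
  intro x y
  rw [Ring.lie_def]
  change (Z * W) (x * y) - (W * Z) (x * y) = ((Z * W) x - (W * Z) x) * _ +
    _ * ((Z * W) y - (W * Z) y)
  rw [key hZ hW, key hW hZ]
  ring

end IsInfinitesimalCharacter

theorem IsInfinitesimalCharacter.rOp {Z : ConvMap H Laurent} (hZ : IsInfinitesimalCharacter Z) :
    IsInfinitesimalCharacter (rOp Z) := hZ.post _

theorem IsInfinitesimalCharacter.mulLam {Z : ConvMap H Laurent} (hZ : IsInfinitesimalCharacter Z)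
    (k : ℤ) : IsInfinitesimalCharacter (mulLam k Z) := hZ.post _

variable {𝒢 : ℕ → Submodule ℂ H} [GradedAlgebra 𝒢]

theorem gradingY_apply {n : ℕ} {x : H} (hx : x ∈ 𝒢 n) : gradingY 𝒢 x = (n : ℂ) • x := by
  lift x to 𝒢 n using hx
  simp [gradingY]

theorem gradingY_mul (x y : H) :
    gradingY 𝒢 (x * y) = gradingY 𝒢 x * y + x * gradingY 𝒢 y := by
  induction x using DirectSum.Decomposition.inductionOn 𝒢 with
  | zero => simp
  | add x x' hx hx' => rw [add_mul, map_add, map_add, hx, hx']; ring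
  | @homogeneous p x =>
    induction y using DirectSum.Decomposition.inductionOn 𝒢 with
    | zero => simp
    | add y y' hy hy' => rw [mul_add, map_add, map_add, hy, hy']; ring
    | @homogeneous q y =>
      rw [gradingY_apply x.2, gradingY_apply y.2, gradingY_apply (SetLike.mul_mem_graded x.2 y.2)]
      rw [smul_mul_assoc, mul_smul_comm, ← add_smul, Nat.cast_add]

theorem counit_gradingY (h𝒢 : IsConnectedGradedHopf 𝒢) (x : H) :
    counit (R := ℂ) (gradingY 𝒢 x) = 0 := by
  induction x using DirectSum.Decomposition.inductionOn 𝒢 with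
  | zero => simp
  | add x x' hx hx' => rw [map_add, map_add, hx, hx', add_zero]
  | @homogeneous p x =>
    rw [gradingY_apply x.2, map_smul]
    rcases eq_or_ne p 0 with rfl | hp
    · simp
    · rw [h𝒢.counit_eq_zero p hp _ x.2, smul_zero]

variable (𝒢) in
/-- The derivation `f ↦ f ∘ Y` of the convolution algebra. -/
def ConvMap.compY (f : ConvMap H A) : ConvMap H A :=
  WithConv.toConv (f.ofConv ∘ₗ gradingY 𝒢)

theorem ConvMap.compY_apply (f : ConvMap H A) (x : H) : f.compY 𝒢 x = f (gradingY 𝒢 x) := rfl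

/-- Since Δ preserves the total degree, `Y` is a coderivation, and composing with it obeys the
Leibniz rule for convolution. -/
theorem ConvMap.compY_mul (h𝒢 : IsConnectedGradedHopf 𝒢) (f g : ConvMap H A) :
    (f * g).compY 𝒢 = f.compY 𝒢 * g + f * g.compY 𝒢 := by
  refine ConvMap.ext_homogeneous (𝒢 := 𝒢) fun n x hx => ?_
  obtain ⟨s, hs, hsum⟩ := h𝒢.exists_comul_eq_sum hx
  change (f * g) (gradingY 𝒢 x) = (f.compY 𝒢 * g) x + (f * g.compY 𝒢) x
  rw [gradingY_apply hx, map_smul, ConvMap.mul_apply_of_comul _ _ hsum,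
    ConvMap.mul_apply_of_comul _ _ hsum, ConvMap.mul_apply_of_comul _ _ hsum, Finset.smul_sum,
    ← Finset.sum_add_distrib]
  refine Finset.sum_congr rfl fun i hi => ?_
  rw [ConvMap.compY_apply, ConvMap.compY_apply, gradingY_apply i.2.1.2, gradingY_apply i.2.2.2,
    map_smul, map_smul, smul_mul_assoc, mul_smul_comm, ← add_smul, ← hs i hi, Nat.cast_add]

theorem rTilde_eq (φ : Character H) :
    rTilde 𝒢 φ = (φ⁻¹).toConvMap * φ.toConvMap.compY 𝒢 := rfl

theorem rTilde_eq_iff {φ : Character H} {Z : ConvMap H Laurent} :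
    rTilde 𝒢 φ = Z ↔ φ.toConvMap.compY 𝒢 = φ.toConvMap * Z := by
  rw [rTilde_eq]
  constructor
  · rintro rfl
    rw [← mul_assoc, Character.toConvMap_mul_inv, one_mul]
  · intro h
    rw [h, ← mul_assoc, Character.toConvMap_inv_mul, one_mul]

/-- Expanding over Δx Δy, the derivation `Y` falls on one argument only; on the other argument φ⁻¹ ⋆
φ collapses to the counit. -/
theorem rTilde_infinitesimal (φ : Character H) : IsInfinitesimalCharacter (rTilde 𝒢 φ) := by
  intro x y
  rw [rTilde_eq]
  set r := Coalgebra.Repr.arbitrary ℂ x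
  set t := Coalgebra.Repr.arbitrary ℂ y
  have e : ∀ f g : ConvMap H Laurent, ∀ f' g' : ConvMap H Laurent,
      ∑ i ∈ r.index, ∑ j ∈ t.index, (f (r.left i) * g (r.right i)) *
        (f' (t.left j) * g' (t.right j)) = (f * g) x * (f' * g') y := by
    intro f g f' g'
    rw [r.convMul_apply, t.convMul_apply, Finset.sum_mul_sum]
  have e1 := e (φ⁻¹).toConvMap (φ.toConvMap.compY 𝒢) (φ⁻¹).toConvMap φ.toConvMap
  have e2 := e (φ⁻¹).toConvMap φ.toConvMap (φ⁻¹).toConvMap (φ.toConvMap.compY 𝒢)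
  rw [Character.toConvMap_inv_mul] at e1 e2
  change _ = _ * algebraMap ℂ Laurent (counit (R := ℂ) y) at e1
  change _ = algebraMap ℂ Laurent (counit (R := ℂ) x) * _ at e2
  rw [ConvMap.mul_apply_mul _ _ r t, ← e1, ← e2]
  simp only [← Finset.sum_add_distrib]
  refine Finset.sum_congr rfl fun i _ => Finset.sum_congr rfl fun j _ => ?_
  simp only [ConvMap.compY_apply, gradingY_mul, Character.toConvMap_apply, map_mul, map_add]
  ring

variable (𝒢) in
/-- The linear map `x ↦ x / n` for `x` homogeneous of degree `n > 0`, and `x ↦ 0` in degree `0`. -/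
def divDegree : H →ₗ[ℂ] H :=
  (DirectSum.toModule ℂ ℕ H fun n => (n : ℂ)⁻¹ • (𝒢 n).subtype) ∘ₗ
    (DirectSum.decomposeLinearEquiv 𝒢).toLinearMap

theorem divDegree_apply {n : ℕ} {x : H} (hx : x ∈ 𝒢 n) : divDegree 𝒢 x = (n : ℂ)⁻¹ • x := by
  lift x to 𝒢 n using hx
  simp [divDegree]

/-- In degree n > 0 the equation reads u(x) = n⁻¹ (u ⋆ Z)(x). The top term `u x * Z 1` is zero, so
the right side involves only smaller degrees. -/
theorem exists_linear_rTilde (h𝒢 : IsConnectedGradedHopf 𝒢) {Z : ConvMap H Laurent}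
    (hZ : Z 1 = 0) : ∃ u : ConvMap H Laurent, u 1 = 1 ∧ u.compY 𝒢 = u * Z := by
  obtain ⟨u, hu⟩ := exists_fixedPoint_of_triangular (𝒢 := 𝒢)
    (fun f : ConvMap H Laurent => 1 + WithConv.toConv ((f * Z).ofConv ∘ₗ divDegree 𝒢)) (by
      intro d f g hfg x hx
      obtain ⟨s, hs, hsum⟩ := h𝒢.exists_comul_eq_add hx
      change algebraMap ℂ Laurent (counit (R := ℂ) x) + (f * Z) (divDegree 𝒢 x) =
        algebraMap ℂ Laurent (counit (R := ℂ) x) + (g * Z) (divDegree 𝒢 x)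
      rw [divDegree_apply hx, map_smul, map_smul, ConvMap.mul_apply_of_comul_add _ _ hsum,
        ConvMap.mul_apply_of_comul_add _ _ hsum, hZ, mul_zero, mul_zero]
      congr 3
      refine Finset.sum_congr rfl fun i hi => ?_
      rw [hfg i.1.1 (by have := hs i hi; omega) _ i.2.1.2])
  have hu' : ∀ x, u x = algebraMap ℂ Laurent (counit (R := ℂ) x) + (u * Z) (divDegree 𝒢 x) :=
    fun x => congrArg (fun f : ConvMap H Laurent => f x) hu.symm
  refine ⟨u, ?_, ConvMap.ext_homogeneous (𝒢 := 𝒢) fun n x hx => ?_⟩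
  · rw [hu' 1, divDegree_apply (SetLike.GradedOne.one_mem (A := 𝒢))]
    simp
  · rw [ConvMap.compY_apply, gradingY_apply hx, map_smul]
    rcases Nat.eq_zero_or_pos n with rfl | hn
    · rw [h𝒢.eq_smul_one hx, map_smul (u * Z).ofConv, ConvMap.mul_apply_one, hZ]
      simp
    · have hn' : (n : ℂ) ≠ 0 := by exact_mod_cast hn.ne'
      rw [hu', h𝒢.counit_eq_zero n hn.ne' x hx, divDegree_apply hx, map_smul, map_zero, zero_add,
        smul_smul, mul_inv_cancel₀ hn', one_smul]

/-- After multiplication by the total degree p + q, both sides satisfy the same recursion, by the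
Leibniz rule for `Z`. -/
theorem linear_rTilde_mul (h𝒢 : IsConnectedGradedHopf 𝒢) {Z : ConvMap H Laurent}
    (hZ : IsInfinitesimalCharacter Z) {u : ConvMap H Laurent} (h1 : u 1 = 1)
    (hu : u.compY 𝒢 = u * Z) (n : ℕ) :
    ∀ p q, p + q = n → ∀ x ∈ 𝒢 p, ∀ y ∈ 𝒢 q, u (x * y) = u x * u y := by
  induction n using Nat.strong_induction_on with
  | _ n ih =>
  intro p q hpq x hx y hy
  rcases Nat.eq_zero_or_pos p with rfl | hp0
  · rw [h𝒢.eq_smul_one hx]; simp [h1]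
  obtain ⟨s, hs, hsx⟩ := h𝒢.exists_comul_eq_add hx
  obtain ⟨t, ht, hty⟩ := h𝒢.exists_comul_eq_add hy
  have hY : ∀ {d : ℕ} {z : H}, z ∈ 𝒢 d → (d : ℂ) • u z = (u * Z) z := by
    intro d z hz
    rw [← hu, ConvMap.compY_apply, gradingY_apply hz, map_smul]
  have hc : ((p + q : ℕ) : ℂ) ≠ 0 := by exact_mod_cast (by omega)
  have ex := hY hx
  have ey := hY hy
  rw [ConvMap.mul_apply_of_comul_add _ _ hsx, hZ.map_one, mul_zero, zero_add] at ex
  rw [ConvMap.mul_apply_of_comul_add _ _ hty, hZ.map_one, mul_zero, zero_add] at ey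
  refine smul_right_injective Laurent hc ?_
  change ((p + q : ℕ) : ℂ) • u (x * y) = ((p + q : ℕ) : ℂ) • (u x * u y)
  rw [hY (SetLike.mul_mem_graded hx hy), ConvMap.mul_apply_mul_of_comul_add _ _ hsx hty,
    hZ.map_one, mul_zero, zero_add, Nat.cast_add, add_smul, ← smul_mul_assoc, ← mul_smul_comm,
    ex, ey, Finset.sum_mul, Finset.mul_sum]
  -- All right factors have positive degree, so their counits vanish and `Z` kills their products.
  have e3 : ∑ i ∈ s, ∑ j ∈ t, u (i.2.1 * j.2.1) * Z (i.2.2 * j.2.2) = 0 := by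
    refine Finset.sum_eq_zero fun i hi => Finset.sum_eq_zero fun j hj => ?_
    rw [hZ, h𝒢.counit_eq_zero _ (hs i hi).2.ne' _ i.2.2.2,
      h𝒢.counit_eq_zero _ (ht j hj).2.ne' _ j.2.2.2]
    simp
  rw [e3, add_zero, add_comm]
  congr 1
  · refine Finset.sum_congr rfl fun i hi => ?_
    have := hs i hi
    rw [ih (i.1.1 + q) (by omega) _ _ rfl _ i.2.1.2 y hy]
    ring
  · refine Finset.sum_congr rfl fun j hj => ?_
    have := ht j hj
    rw [ih (p + j.1.1) (by omega) _ _ rfl x hx _ j.2.1.2]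
    ring

theorem exists_rTilde_eq (h𝒢 : IsConnectedGradedHopf 𝒢) {Z : ConvMap H Laurent}
    (hZ : IsInfinitesimalCharacter Z) : ∃ φ : Character H, rTilde 𝒢 φ = Z := by
  obtain ⟨u, h1, hu⟩ := exists_linear_rTilde h𝒢 hZ.map_one
  exact ⟨Character.ofHomogeneous 𝒢 u h1 fun p q => linear_rTilde_mul h𝒢 hZ h1 hu (p + q) p q rfl,
    rTilde_eq_iff.2 hu⟩

theorem rTilde_apply_homogeneous {φ : Character H} {n : ℕ} {x : H} (hx : x ∈ 𝒢 n) :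
    (n : ℂ) • φ x = (φ.toConvMap * rTilde 𝒢 φ) x := by
  rw [← rTilde_eq_iff.1 rfl, ConvMap.compY_apply, gradingY_apply hx, map_smul]
  rfl

theorem rTilde_injective (h𝒢 : IsConnectedGradedHopf 𝒢) :
    Function.Injective (rTilde 𝒢 : Character H → ConvMap H Laurent) := by
  intro φ ψ h
  have key : ∀ n, ∀ x ∈ 𝒢 n, φ x = ψ x := by
    intro n
    induction n using Nat.strong_induction_on with
    | _ n ih =>
    intro x hx
    rcases Nat.eq_zero_or_pos n with rfl | hn
    · rw [h𝒢.eq_smul_one hx]; simp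
    have hn' : (n : ℂ) ≠ 0 := by exact_mod_cast hn.ne'
    refine smul_right_injective Laurent hn' ?_
    change (n : ℂ) • φ x = (n : ℂ) • ψ x
    obtain ⟨s, hs, hsum⟩ := h𝒢.exists_comul_eq_add hx
    rw [rTilde_apply_homogeneous hx, rTilde_apply_homogeneous hx, h,
      ConvMap.mul_apply_of_comul_add _ _ hsum, ConvMap.mul_apply_of_comul_add _ _ hsum,
      (rTilde_infinitesimal ψ).map_one, mul_zero, mul_zero]
    congr 1
    refine Finset.sum_congr rfl fun i hi => ?_
    have := hs i hi
    rw [Character.toConvMap_apply, Character.toConvMap_apply, ih i.1.1 (by omega) _ i.2.1.2]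
  exact Character.toConvMap_injective (ConvMap.ext_homogeneous key)

end Hopf

/-! ### The scaled characters φ^s and the criterion for locality -/

theorem lam_mul_lam (k l : ℤ) : lam k * lam l = lam (k + l) := by
  refine Laurent.ext fun j => ?_
  have h1 := coeff_lam_mul k (lam l) j
  have h2 : ∀ m i : ℤ, (lam m).coeff i = (1 : Laurent).coeff (i - m) := fun m i => by
    rw [← coeff_lam_mul, mul_one]
  rw [h1, h2, h2, sub_sub]

theorem lam_zero : lam 0 = 1 := rfl

section Hopf
variable {H : Type*} [CommRing H] [HopfAlgebra ℂ H]

theorem mulLam_apply (k : ℤ) (f : ConvMap H Laurent) (x : H) : mulLam k f x = lam k * f x := rfl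

theorem mulLam_mul (k : ℤ) (f g : ConvMap H Laurent) : mulLam k f * g = mulLam k (f * g) := by
  refine ConvMap.ext_apply fun x => ?_
  rw [mulLam_apply, (Coalgebra.Repr.arbitrary ℂ x).convMul_apply,
    (Coalgebra.Repr.arbitrary ℂ x).convMul_apply, Finset.mul_sum]
  exact Finset.sum_congr rfl fun i _ => by rw [mulLam_apply, mul_assoc]

theorem mul_mulLam (k : ℤ) (f g : ConvMap H Laurent) : f * mulLam k g = mulLam k (f * g) := by
  refine ConvMap.ext_apply fun x => ?_
  rw [mulLam_apply, (Coalgebra.Repr.arbitrary ℂ x).convMul_apply,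
    (Coalgebra.Repr.arbitrary ℂ x).convMul_apply, Finset.mul_sum]
  exact Finset.sum_congr rfl fun i _ => by rw [mulLam_apply, mul_left_comm]

theorem mulLam_mulLam (k l : ℤ) (f : ConvMap H Laurent) :
    mulLam k (mulLam l f) = mulLam (k + l) f :=
  ConvMap.ext_apply fun x => by rw [mulLam_apply, mulLam_apply, mulLam_apply, ← mul_assoc,
    lam_mul_lam]

theorem mulLam_zero (f : ConvMap H Laurent) : mulLam 0 f = f :=
  ConvMap.ext_apply fun x => by rw [mulLam_apply, lam_zero, one_mul]

variable {𝒢 : ℕ → Submodule ℂ H} [GradedAlgebra 𝒢]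

theorem scaleChar_apply (s : ℂ) (φ : Character H) {n : ℕ} {x : H} (hx : x ∈ 𝒢 n) :
    scaleChar 𝒢 s φ x = expLam (s * n) * φ x := by
  lift x to 𝒢 n using hx
  simp [scaleChar, scaleComponent]

variable (𝒢) in
/-- The maps `φ⁻¹ ⋆ (λ ^ n φ ∘ Y ^ n)`, the coefficients of the expansion of `φ⁻¹ ⋆ φ ^ s` in powers
of `s`. -/
def scaleCoeff (φ : Character H) (n : ℕ) : ConvMap H Laurent :=
  (φ⁻¹).toConvMap * mulLam n ((ConvMap.compY 𝒢)^[n] φ.toConvMap)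

theorem ConvMap.compY_iterate_apply (f : ConvMap H Laurent) (n : ℕ) {q : ℕ} {x : H}
    (hx : x ∈ 𝒢 q) : ((ConvMap.compY 𝒢)^[n] f) x = (q : ℂ) ^ n • f x := by
  induction n with
  | zero => simp
  | succ n ih =>
    rw [Function.iterate_succ_apply', ConvMap.compY_apply, gradingY_apply hx, map_smul, ih,
      smul_smul, pow_succ']

theorem scaleCoeff_one (φ : Character H) : scaleCoeff 𝒢 φ 1 = mulLam 1 (rTilde 𝒢 φ) := by
  rw [rTilde_eq, ← mul_mulLam]; rfl

theorem scaleCoeff_zero (φ : Character H) : scaleCoeff 𝒢 φ 0 = 1 := by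
  rw [← Character.toConvMap_inv_mul φ, ← mulLam_zero φ.toConvMap]; rfl

/-- Obtained by composing φ ⋆ c_n = λ^n φ∘Y^n with `Y` and multiplying by λ. It shows that
holomorphy of the first coefficient passes to all of them. -/
theorem scaleCoeff_succ (h𝒢 : IsConnectedGradedHopf 𝒢) (φ : Character H) (n : ℕ) :
    scaleCoeff 𝒢 φ (n + 1) =
      scaleCoeff 𝒢 φ 1 * scaleCoeff 𝒢 φ n + mulLam 1 ((scaleCoeff 𝒢 φ n).compY 𝒢) := by
  have h : φ.toConvMap * scaleCoeff 𝒢 φ n = mulLam n ((ConvMap.compY 𝒢)^[n] φ.toConvMap) := by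
    rw [scaleCoeff, ← mul_assoc, Character.toConvMap_mul_inv, one_mul]
  have h1 : mulLam (n + 1 : ℕ) ((ConvMap.compY 𝒢)^[n + 1] φ.toConvMap) =
      mulLam 1 ((φ.toConvMap * scaleCoeff 𝒢 φ n).compY 𝒢) := by
    rw [h, Function.iterate_succ_apply', Nat.cast_succ, add_comm, ← mulLam_mulLam]
    rfl
  rw [scaleCoeff, h1, ConvMap.compY_mul h𝒢, scaleCoeff_one, rTilde_eq]
  have e : mulLam 1 (φ.toConvMap.compY 𝒢 * scaleCoeff 𝒢 φ n +
      φ.toConvMap * (scaleCoeff 𝒢 φ n).compY 𝒢) = mulLam 1 (φ.toConvMap.compY 𝒢) *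
        scaleCoeff 𝒢 φ n + φ.toConvMap * mulLam 1 ((scaleCoeff 𝒢 φ n).compY 𝒢) := by
    rw [mulLam_mul, mul_mulLam]
    exact ConvMap.ext_apply fun x => mul_add _ _ _
  rw [e, mul_add, ← mul_mulLam, mul_assoc, ← mul_assoc _ φ.toConvMap,
    Character.toConvMap_inv_mul, one_mul]

/-- Pole orders are bounded over the finitely many terms of Δx, so each Laurent coefficient is a
polynomial in `s`, with a truncation valid for all `s`. Differentiation in `s` is thus elementary.
-/
theorem exists_scaleChar_expansion (h𝒢 : IsConnectedGradedHopf 𝒢) (φ : Character H) (x : H) (j : ℤ) :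
    ∃ N₀ : ℕ, ∀ N ≥ N₀, ∀ s : ℂ, ((φ⁻¹ * scaleChar 𝒢 s φ) x).coeff j =
      ∑ n ∈ Finset.range N, s ^ n / n.factorial * (scaleCoeff 𝒢 φ n x).coeff j := by
  induction x using DirectSum.Decomposition.inductionOn 𝒢 with
  | zero => exact ⟨0, fun N _ s => by simp⟩
  | add x y hx hy =>
    obtain ⟨N₁, h₁⟩ := hx
    obtain ⟨N₂, h₂⟩ := hy
    refine ⟨max N₁ N₂, fun N hN s => ?_⟩
    rw [map_add, coeff_add, h₁ N (le_trans (le_max_left _ _) hN),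
      h₂ N (le_trans (le_max_right _ _) hN), ← Finset.sum_add_distrib]
    exact Finset.sum_congr rfl fun n _ => by rw [map_add, coeff_add, mul_add]
  | @homogeneous p x =>
    obtain ⟨S, hS, hsum⟩ := h𝒢.exists_comul_eq_sum x.2
    choose N₀ hN₀ using fun i : HomogeneousPair 𝒢 =>
      exists_coeff_expLam_mul (φ⁻¹ i.2.1 * φ i.2.2) j
    refine ⟨S.sup N₀, fun N hN s => ?_⟩
    have h1 : (φ⁻¹ * scaleChar 𝒢 s φ) (x : H) =
        ((φ⁻¹).toConvMap * (scaleChar 𝒢 s φ).toConvMap) x := rfl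
    rw [h1, ConvMap.mul_apply_of_comul _ _ hsum, coeff_sum]
    have h2 : ∀ n, (scaleCoeff 𝒢 φ n x).coeff j = ∑ i ∈ S,
        (i.1.2 : ℂ) ^ n * (lam n * (φ⁻¹ i.2.1 * φ i.2.2)).coeff j := by
      intro n
      rw [scaleCoeff, ConvMap.mul_apply_of_comul _ _ hsum, coeff_sum]
      refine Finset.sum_congr rfl fun i _ => ?_
      rw [mulLam_apply, ConvMap.compY_iterate_apply _ _ i.2.2.2, mul_smul_comm, mul_smul_comm,
        coeff_smul, mul_left_comm]
      rfl
    simp only [h2, Finset.mul_sum]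
    rw [Finset.sum_comm]
    refine Finset.sum_congr rfl fun i hi => ?_
    rw [Character.toConvMap_apply, Character.toConvMap_apply, scaleChar_apply s φ i.2.2.2,
      mul_left_comm, hN₀ i N (le_trans (Finset.le_sup hi) hN)]
    refine Finset.sum_congr rfl fun n _ => ?_
    rw [mul_pow]
    ring

/-- `β̃_φ = λ R̃(φ)`. -/
theorem isBetaCharacter_mulLam_rTilde (h𝒢 : IsConnectedGradedHopf 𝒢) (φ : Character H) :
    IsBetaCharacter 𝒢 φ (mulLam 1 (rTilde 𝒢 φ)) := by
  intro x j
  obtain ⟨N, hN⟩ := exists_scaleChar_expansion h𝒢 φ x j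
  have h := hN (N + 2) (by omega)
  rw [funext h, ← scaleCoeff_one]
  have hd : HasDerivAt (fun s : ℂ => ∑ n ∈ Finset.range (N + 2),
      s ^ n / n.factorial * (scaleCoeff 𝒢 φ n x).coeff j)
      (∑ n ∈ Finset.range (N + 2),
        n * (0 : ℂ) ^ (n - 1) / n.factorial * (scaleCoeff 𝒢 φ n x).coeff j) 0 :=
    HasDerivAt.fun_sum fun n _ => ((hasDerivAt_pow n 0).div_const _).mul_const _
  refine hd.congr_deriv ?_
  rw [Finset.sum_eq_single 1]
  · simp
  · intro n _ hn
    rcases n with _ | _ | n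
    · simp
    · exact absurd rfl hn
    · simp
  · intro h
    simp at h

theorem scaleCoeff_holomorphic (h𝒢 : IsConnectedGradedHopf 𝒢) {φ : Character H}
    (h : ∀ x, mulLam 1 (rTilde 𝒢 φ) x ∈ holomorphic) (n : ℕ) :
    ∀ x, scaleCoeff 𝒢 φ n x ∈ holomorphic := by
  induction n with
  | zero => rw [scaleCoeff_zero]; exact fun x => holomorphic.algebraMap_mem _
  | succ n ih =>
    intro x
    rw [scaleCoeff_succ h𝒢, scaleCoeff_one]
    exact add_mem (ConvMap.mul_mem _ h ih x) (mul_mem (lam_mem_holomorphic zero_le_one) (ih _))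

theorem inv_mul_scaleChar_holomorphic (h𝒢 : IsConnectedGradedHopf 𝒢) {φ : Character H}
    (h : ∀ x, mulLam 1 (rTilde 𝒢 φ) x ∈ holomorphic) (s : ℂ) (x : H) :
    (φ⁻¹ * scaleChar 𝒢 s φ) x ∈ holomorphic := by
  rw [mem_holomorphic_iff]
  intro j hj
  obtain ⟨N, hN⟩ := exists_scaleChar_expansion h𝒢 φ x j
  rw [hN N le_rfl]
  refine Finset.sum_eq_zero fun n _ => ?_
  rw [mem_holomorphic_iff.1 (scaleCoeff_holomorphic h𝒢 h n x) j hj, mul_zero]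

theorem scaleChar_zero (φ : Character H) : scaleChar 𝒢 0 φ = φ := by
  refine Character.toConvMap_injective (ConvMap.ext_homogeneous (𝒢 := 𝒢) fun n x hx => ?_)
  rw [Character.toConvMap_apply, scaleChar_apply 0 φ hx, zero_mul, expLam_zero, one_mul]
  rfl

/-- In φ^s = φ ⋆ (φ⁻¹ ⋆ φ^s) the second factor is holomorphic and is absorbed into the plus part;
uniqueness of the decomposition does the rest. -/
theorem minusPart_scaleChar (h𝒢 : IsConnectedGradedHopf 𝒢) {φ : Character H}
    (h : ∀ x, mulLam 1 (rTilde 𝒢 φ) x ∈ holomorphic) (s : ℂ) :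
    minusPart (scaleChar 𝒢 s φ) = minusPart φ := by
  have hb := isBirkhoff_birkhoff h𝒢 φ
  have h' : IsBirkhoff (scaleChar 𝒢 s φ)
      (minusPart φ, plusPart φ * (φ⁻¹ * scaleChar 𝒢 s φ)) := by
    refine ⟨?_, hb.minus, ?_⟩
    · have := hb.eq
      rw [← mul_assoc, ← this, mul_inv_cancel_left]
    · exact ConvMap.mul_mem holomorphic (f := (plusPart φ).toConvMap)
        (g := (φ⁻¹ * scaleChar 𝒢 s φ).toConvMap) hb.plus (inv_mul_scaleChar_holomorphic h𝒢 h s)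
  exact (Prod.ext_iff.1 ((isBirkhoff_birkhoff h𝒢 (scaleChar 𝒢 s φ)).unique h')).1

/-- A character `φ` is local if and only if `λ R̃(φ)` is holomorphic. -/
theorem isLocalCharacter_iff (h𝒢 : IsConnectedGradedHopf 𝒢) {φ : Character H} :
    IsLocalCharacter 𝒢 φ ↔ ∀ x, mulLam 1 (rTilde 𝒢 φ) x ∈ holomorphic := by
  constructor
  · intro h
    have hm : ∀ s, minusPart (scaleChar 𝒢 s φ) = minusPart φ := by
      intro s
      refine Character.ext' fun x => Laurent.ext fun j => ?_
      have := is_const_of_deriv_eq_zero (𝕜 := ℂ)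
        (f := fun s => (minusPart (scaleChar 𝒢 s φ) x).coeff j)
        (fun t => (h t x j).differentiableAt) (fun t => (h t x j).deriv) s 0
      simpa only [scaleChar_zero] using this
    have hhol : ∀ s x, (φ⁻¹ * scaleChar 𝒢 s φ) x ∈ holomorphic := by
      intro s
      have h1 := (isBirkhoff_birkhoff h𝒢 φ)
      have h2 := (isBirkhoff_birkhoff h𝒢 (scaleChar 𝒢 s φ))
      -- The equal minus parts cancel, leaving a quotient of holomorphic characters, whose
      -- derivative at s = 0 is λR̃(φ).
      have e : φ⁻¹ * scaleChar 𝒢 s φ = (plusPart φ)⁻¹ * plusPart (scaleChar 𝒢 s φ) := by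
        have e1 := h1.eq
        have e2 := h2.eq
        simp only [hm s] at e1 e2
        refine (congrArg₂ (fun a b => a⁻¹ * b) e1 e2).trans ?_
        group
      rw [e]
      exact ConvMap.mul_mem holomorphic (f := ((plusPart φ)⁻¹).toConvMap)
        (g := (plusPart (scaleChar 𝒢 s φ)).toConvMap) (fun x => h1.plus _) h2.plus
    intro x
    rw [mem_holomorphic_iff]
    intro j hj
    have hd := isBetaCharacter_mulLam_rTilde h𝒢 φ x j
    rw [funext fun s => mem_holomorphic_iff.1 (hhol s x) j hj] at hd
    exact hd.unique (hasDerivAt_const _ _)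
  · intro h t x j
    simp only [minusPart_scaleChar h𝒢 h]
    exact hasDerivAt_const _ _

end Hopf

/-! ### The Lax flow: power series in t, locality, uniqueness -/

namespace HasLaurentDerivAt
variable {K : Type*} [NontriviallyNormedField K] [NormedSpace K ℂ]

theorem add {f g : K → Laurent} {f' g' : Laurent} {t : K} (hf : HasLaurentDerivAt f f' t)
    (hg : HasLaurentDerivAt g g' t) : HasLaurentDerivAt (fun s => f s + g s) (f' + g') t :=
  fun j => (hf j).add (hg j)

theorem const (a : Laurent) (t : K) : HasLaurentDerivAt (fun _ => a) 0 t :=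
  fun _ => hasDerivAt_const _ _

end HasLaurentDerivAt

/-- Regrouping a double sum along the antidiagonals. -/
theorem Finset.sum_range_range_eq_sum_antidiagonal {M : Type*} [AddCommMonoid M] (F : ℕ → ℕ → M)
    {d D : ℕ} (hD : D ≤ d) (hF : ∀ i j, D ≤ i + j → F i j = 0) :
    ∑ i ∈ Finset.range d, ∑ j ∈ Finset.range d, F i j =
      ∑ n ∈ Finset.range D, ∑ p ∈ Finset.HasAntidiagonal.antidiagonal n, F p.1 p.2 := by
  classical
  rw [← Finset.sum_product']
  rw [← Finset.sum_filter_of_ne (p := fun p : ℕ × ℕ => p.1 + p.2 < D)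
    (fun p _ hp => by by_contra h; exact hp (hF _ _ (not_lt.1 h)))]
  rw [← Finset.sum_fiberwise_of_maps_to (s := _) (t := Finset.range D)
    (g := fun p : ℕ × ℕ => p.1 + p.2) (fun p hp => by simpa using (Finset.mem_filter.1 hp).2)]
  refine Finset.sum_congr rfl fun n hn => Finset.sum_congr ?_ fun _ _ => rfl
  ext p
  simp only [Finset.mem_filter, Finset.mem_product, Finset.mem_range,
    Finset.HasAntidiagonal.mem_antidiagonal] at hn ⊢
  omega

section Hopf
variable {H : Type*} [CommRing H] [HopfAlgebra ℂ H]

section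
variable {A : Type*} [CommRing A] [Algebra ℂ A]

theorem ConvMap.sum_apply {ι : Type*} (s : Finset ι) (f : ι → ConvMap H A) (x : H) :
    (∑ i ∈ s, f i) x = ∑ i ∈ s, f i x :=
  (congrArg (fun f : H →ₗ[ℂ] A => f x) (WithConv.ofConv_sum s f)).trans (LinearMap.sum_apply _ _ _)

theorem ConvMap.post_sum_smul {ι : Type*} (p : Laurent →ₗ[ℂ] A) (s : Finset ι) (c : ι → ℂ)
    (f : ι → ConvMap H Laurent) :
    ConvMap.post p (∑ i ∈ s, c i • f i) = ∑ i ∈ s, c i • ConvMap.post p (f i) := by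
  refine ConvMap.ext_apply fun x => ?_
  rw [ConvMap.sum_apply]
  change p ((∑ i ∈ s, c i • f i) x) = _
  rw [ConvMap.sum_apply, map_sum]
  exact Finset.sum_congr rfl fun i _ => map_smul p _ _

theorem ConvMap.smul_apply (c : ℂ) (f : ConvMap H A) (x : H) : (c • f) x = c • f x := rfl

theorem ConvMap.lie_sub (f g h : ConvMap H A) : ⁅f, g - h⁆ = ⁅f, g⁆ - ⁅f, h⁆ := by
  rw [Ring.lie_def, Ring.lie_def, Ring.lie_def, mul_sub, sub_mul]
  abel

theorem ConvMap.lie_smul (c : ℂ) (f g : ConvMap H A) : ⁅f, c • g⁆ = c • ⁅f, g⁆ := by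
  rw [Ring.lie_def, Ring.lie_def, smul_sub, smul_mul_assoc, mul_smul_comm]

theorem ConvMap.lie_apply (f g : ConvMap H A) (x : H) :
    ⁅f, g⁆ x = (f * g) x - (g * f) x := rfl

variable {𝒢 : ℕ → Submodule ℂ H} [GradedAlgebra 𝒢]

theorem ConvMap.mul_congr (h𝒢 : IsConnectedGradedHopf 𝒢) {f f' g g' : ConvMap H A} {d : ℕ}
    (hf : ∀ e ≤ d, ∀ y ∈ 𝒢 e, f y = f' y) (hg : ∀ e ≤ d, ∀ y ∈ 𝒢 e, g y = g' y) {x : H}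
    (hx : x ∈ 𝒢 d) : (f * g) x = (f' * g') x := by
  obtain ⟨s, hs, hsum⟩ := h𝒢.exists_comul_eq_sum hx
  rw [ConvMap.mul_apply_of_comul _ _ hsum, ConvMap.mul_apply_of_comul _ _ hsum]
  refine Finset.sum_congr rfl fun i hi => ?_
  have := hs i hi
  rw [hf i.1.1 (by omega) _ i.2.1.2, hg i.1.2 (by omega) _ i.2.2.2]

/-- For maps vanishing in degree `0` the convolution product in degree `d` depends only on the
values in degrees below `d`. -/
theorem ConvMap.mul_congr_of_lt (h𝒢 : IsConnectedGradedHopf 𝒢) {f f' g g' : ConvMap H A} {d : ℕ}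
    (hf1 : f 1 = 0) (hf1' : f' 1 = 0) (hg1 : g 1 = 0) (hg1' : g' 1 = 0)
    (hf : ∀ e < d, ∀ y ∈ 𝒢 e, f y = f' y) (hg : ∀ e < d, ∀ y ∈ 𝒢 e, g y = g' y) {x : H}
    (hx : x ∈ 𝒢 d) : (f * g) x = (f' * g') x := by
  have h0 : ∀ h : ConvMap H A, h 1 = 0 → ∀ e, e = 0 → ∀ y ∈ 𝒢 e, h y = 0 := by
    rintro h h1 _ rfl y hy
    rw [h𝒢.eq_smul_one hy, map_smul, h1, smul_zero]
  obtain ⟨s, hs, hsum⟩ := h𝒢.exists_comul_eq_sum hx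
  rw [ConvMap.mul_apply_of_comul _ _ hsum, ConvMap.mul_apply_of_comul _ _ hsum]
  refine Finset.sum_congr rfl fun i hi => ?_
  have := hs i hi
  by_cases hp : i.1.1 = 0
  · rw [h0 f hf1 _ hp _ i.2.1.2, h0 f' hf1' _ hp _ i.2.1.2, zero_mul, zero_mul]
  by_cases hq : i.1.2 = 0
  · rw [h0 g hg1 _ hq _ i.2.2.2, h0 g' hg1' _ hq _ i.2.2.2, mul_zero, mul_zero]
  rw [hf i.1.1 (by omega) _ i.2.1.2, hg i.1.2 (by omega) _ i.2.2.2]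

/-- A nonzero term needs left degree at least m + 1 and right degree at least n + 1, hence total
degree at least m + n + 2. -/
theorem ConvMap.mul_apply_eq_zero (h𝒢 : IsConnectedGradedHopf 𝒢) {f g : ConvMap H A} {m n d : ℕ}
    (hf : ∀ e ≤ m, ∀ y ∈ 𝒢 e, f y = 0) (hg : ∀ e ≤ n, ∀ y ∈ 𝒢 e, g y = 0) (hd : d ≤ m + n + 1)
    {x : H} (hx : x ∈ 𝒢 d) : (f * g) x = 0 := by
  obtain ⟨s, hs, hsum⟩ := h𝒢.exists_comul_eq_sum hx
  rw [ConvMap.mul_apply_of_comul _ _ hsum]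
  refine Finset.sum_eq_zero fun i hi => ?_
  have := hs i hi
  rcases le_or_gt i.1.1 m with h | h
  · rw [hf _ h _ i.2.1.2, zero_mul]
  · rw [hg i.1.2 (by omega) _ i.2.2.2, mul_zero]

end

/-- The operator `L ↦ R(λ ^ k L)`. -/
def laxOp (k : ℤ) (Z : ConvMap H Laurent) : ConvMap H Laurent := rOp (mulLam k Z)

theorem laxOp_eq_post (k : ℤ) (Z : ConvMap H Laurent) :
    laxOp k Z = ConvMap.post ((projPlus - projMinus) ∘ₗ LinearMap.mulLeft ℂ (lam k)) Z := rfl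

/-- The coefficients of the expansion in powers of `t` of the solution of the Lax equation. -/
def laxCoeff (k : ℤ) (L₀ : ConvMap H Laurent) : ℕ → ConvMap H Laurent
  | 0 => L₀
  | n + 1 => ((n : ℂ) + 1)⁻¹ •
      ∑ i : Fin (n + 1), ⁅laxCoeff k L₀ i, laxOp k (laxCoeff k L₀ (n - i))⁆
decreasing_by all_goals omega

theorem laxCoeff_zero (k : ℤ) (L₀ : ConvMap H Laurent) : laxCoeff k L₀ 0 = L₀ := by
  rw [laxCoeff]

theorem laxCoeff_succ (k : ℤ) (L₀ : ConvMap H Laurent) (n : ℕ) :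
    laxCoeff k L₀ (n + 1) = ((n : ℂ) + 1)⁻¹ • ∑ p ∈ Finset.HasAntidiagonal.antidiagonal n,
      ⁅laxCoeff k L₀ p.1, laxOp k (laxCoeff k L₀ p.2)⁆ := by
  rw [laxCoeff, Finset.Nat.sum_antidiagonal_eq_sum_range_succ
    (fun i j => ⁅laxCoeff k L₀ i, laxOp k (laxCoeff k L₀ j)⁆), Finset.sum_range]

theorem succ_smul_laxCoeff (k : ℤ) (L₀ : ConvMap H Laurent) (n : ℕ) :
    ((n : ℂ) + 1) • laxCoeff k L₀ (n + 1) = ∑ p ∈ Finset.HasAntidiagonal.antidiagonal n,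
      ⁅laxCoeff k L₀ p.1, laxOp k (laxCoeff k L₀ p.2)⁆ := by
  rw [laxCoeff_succ, smul_smul, mul_inv_cancel₀ (by exact_mod_cast n.succ_ne_zero), one_smul]

theorem laxCoeff_infinitesimal (k : ℤ) {L₀ : ConvMap H Laurent}
    (h : IsInfinitesimalCharacter L₀) (n : ℕ) : IsInfinitesimalCharacter (laxCoeff k L₀ n) := by
  induction n using Nat.strong_induction_on with
  | _ n ih =>
  rcases n with _ | n
  · rwa [laxCoeff_zero]
  · rw [laxCoeff_succ]
    refine (IsInfinitesimalCharacter.sum fun p hp => ?_).smul _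
    have := Finset.HasAntidiagonal.mem_antidiagonal.1 hp
    exact (ih p.1 (by omega)).lie ((ih p.2 (by omega)).mulLam k).rOp

/-- `λ ⁅f, g⁆` is holomorphic if `λ f` and `g` are. -/
theorem mulLam_lie_mem_holomorphic {f g : ConvMap H Laurent}
    (hf : ∀ x, mulLam 1 f x ∈ holomorphic) (hg : ∀ x, g x ∈ holomorphic) (x : H) :
    mulLam 1 ⁅f, g⁆ x ∈ holomorphic := by
  have h : mulLam 1 ⁅f, g⁆ x = (mulLam 1 f * g) x - (g * mulLam 1 f) x := by
    rw [mulLam_mul, mul_mulLam, mulLam_apply, mulLam_apply, mulLam_apply, ConvMap.lie_apply,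
      mul_sub]
  rw [h]
  exact sub_mem (ConvMap.mul_mem _ hf hg x) (ConvMap.mul_mem _ hg hf x)

/-- The holomorphic part of `λ ^ k Z`. -/
def plusLam (k : ℤ) (Z : ConvMap H Laurent) : ConvMap H Laurent :=
  ConvMap.post projPlus (mulLam k Z)

theorem laxOp_eq (k : ℤ) (Z : ConvMap H Laurent) :
    laxOp k Z = (2 : ℂ) • plusLam k Z - mulLam k Z := by
  refine ConvMap.ext_apply fun x => ?_
  change projPlus (mulLam k Z x) - projMinus (mulLam k Z x) =
    (2 : ℂ) • projPlus (mulLam k Z x) - mulLam k Z x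
  have h := projMinus_add_projPlus (mulLam k Z x)
  rw [two_smul]
  linear_combination -h

theorem plusLam_mem_holomorphic (k : ℤ) (Z : ConvMap H Laurent) (x : H) :
    plusLam k Z x ∈ holomorphic := projPlus_mem_holomorphic _

theorem lie_laxOp (k : ℤ) (Z W : ConvMap H Laurent) :
    ⁅Z, laxOp k W⁆ = (2 : ℂ) • ⁅Z, plusLam k W⁆ - mulLam k ⁅Z, W⁆ := by
  have h : ⁅Z, mulLam k W⁆ = mulLam k ⁅Z, W⁆ := by
    rw [Ring.lie_def, Ring.lie_def, mul_mulLam, mulLam_mul]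
    exact ConvMap.ext_apply fun x => (mul_sub _ _ _).symm
  rw [laxOp_eq, ConvMap.lie_sub, ConvMap.lie_smul, h]

/-- As R = 2P₊ - id and λ^k is central, the part -λ^k Z of R(λ^k Z) commutes with `Z`. -/
theorem lie_laxOp_self (k : ℤ) (Z : ConvMap H Laurent) :
    ⁅Z, laxOp k Z⁆ = (2 : ℂ) • ⁅Z, plusLam k Z⁆ := by
  rw [lie_laxOp, Ring.lie_def, Ring.lie_def, sub_self (Z * Z), sub_eq_self]
  exact ConvMap.ext_apply fun x => mul_zero _

/-- The same cancellation for the coefficients of a power series in t: the brackets of `a p.1` with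
`a p.2` cancel in pairs under the swap. -/
theorem sum_antidiagonal_lie_laxOp (k : ℤ) (a : ℕ → ConvMap H Laurent) (n : ℕ) :
    ∑ p ∈ Finset.HasAntidiagonal.antidiagonal n, ⁅a p.1, laxOp k (a p.2)⁆ =
      (2 : ℂ) • ∑ p ∈ Finset.HasAntidiagonal.antidiagonal n, ⁅a p.1, plusLam k (a p.2)⁆ := by
  have h0 : ∑ p ∈ Finset.HasAntidiagonal.antidiagonal n, ⁅a p.1, a p.2⁆ = 0 := by
    simp only [Ring.lie_def]
    rw [Finset.sum_sub_distrib, sub_eq_zero]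
    exact (Finset.Nat.sum_antidiagonal_swap (n := n) (f := fun p => a p.1 * a p.2)).symm
  simp only [lie_laxOp, Finset.sum_sub_distrib, Finset.smul_sum]
  rw [sub_eq_self]
  refine ConvMap.ext_apply fun x => ?_
  rw [ConvMap.sum_apply]
  simp only [mulLam_apply]
  rw [← Finset.mul_sum, ← ConvMap.sum_apply, h0]
  exact mul_zero _

theorem laxCoeff_holomorphic (k : ℤ) {L₀ : ConvMap H Laurent}
    (h : ∀ x, mulLam 1 L₀ x ∈ holomorphic) (n : ℕ) :
    ∀ x, mulLam 1 (laxCoeff k L₀ n) x ∈ holomorphic := by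
  induction n using Nat.strong_induction_on with
  | _ n ih =>
  intro x
  rcases n with _ | n
  · rw [laxCoeff_zero]; exact h x
  · rw [laxCoeff_succ, sum_antidiagonal_lie_laxOp, smul_smul, mulLam_apply]
    rw [ConvMap.smul_apply, mul_smul_comm, ConvMap.sum_apply, Finset.mul_sum]
    refine holomorphic.smul_mem (sum_mem fun p hp => ?_) _
    have := Finset.HasAntidiagonal.mem_antidiagonal.1 hp
    exact mulLam_lie_mem_holomorphic (ih _ (by omega)) (plusLam_mem_holomorphic _ _) x

variable {𝒢 : ℕ → Submodule ℂ H} [GradedAlgebra 𝒢]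

/-- The coefficient of t^n is built from brackets of n + 1 factors, each vanishing in degree 0.
Hence the series in t is finite in every degree. -/
theorem laxCoeff_apply_eq_zero (h𝒢 : IsConnectedGradedHopf 𝒢) (k : ℤ) {L₀ : ConvMap H Laurent}
    (h : L₀ 1 = 0) (n : ℕ) : ∀ d ≤ n, ∀ x ∈ 𝒢 d, laxCoeff k L₀ n x = 0 := by
  induction n using Nat.strong_induction_on with
  | _ n ih =>
  intro d hd x hx
  rcases n with _ | n
  · obtain rfl : d = 0 := by omega
    rw [laxCoeff_zero, h𝒢.eq_smul_one hx, map_smul, h, smul_zero]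
  · rw [laxCoeff_succ]
    rw [ConvMap.smul_apply, ConvMap.sum_apply, Finset.sum_eq_zero, smul_zero]
    intro p hp
    have hp := Finset.HasAntidiagonal.mem_antidiagonal.1 hp
    have h2 : ∀ e ≤ p.2, ∀ y ∈ 𝒢 e, laxOp k (laxCoeff k L₀ p.2) y = 0 := by
      intro e he y hy
      rw [laxOp_eq_post]
      change ((projPlus - projMinus) ∘ₗ LinearMap.mulLeft ℂ (lam k)) (laxCoeff k L₀ p.2 y) = 0
      rw [ih p.2 (by omega) e he y hy, map_zero]
    rw [ConvMap.lie_apply, ConvMap.mul_apply_eq_zero h𝒢 (ih p.1 (by omega)) h2 (by omega) hx,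
      ConvMap.mul_apply_eq_zero h𝒢 h2 (ih p.1 (by omega)) (by omega) hx, sub_zero]

variable (𝒢) in
/-- The solution of the Lax equation, as a power series in `t` that is finite in each degree. -/
def laxFlow (k : ℤ) (L₀ : ConvMap H Laurent) (t : ℝ) : ConvMap H Laurent :=
  WithConv.toConv ((DirectSum.toModule ℂ ℕ Laurent fun d =>
    (∑ n ∈ Finset.range d, (t : ℂ) ^ n • laxCoeff k L₀ n).ofConv ∘ₗ (𝒢 d).subtype) ∘ₗ
    (DirectSum.decomposeLinearEquiv 𝒢).toLinearMap)

theorem laxFlow_apply (h𝒢 : IsConnectedGradedHopf 𝒢) (k : ℤ) {L₀ : ConvMap H Laurent}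
    (h : L₀ 1 = 0) (t : ℝ) {d N : ℕ} (hN : d ≤ N) {x : H} (hx : x ∈ 𝒢 d) :
    laxFlow 𝒢 k L₀ t x = (∑ n ∈ Finset.range N, (t : ℂ) ^ n • laxCoeff k L₀ n) x := by
  have h1 : laxFlow 𝒢 k L₀ t x = (∑ n ∈ Finset.range d, (t : ℂ) ^ n • laxCoeff k L₀ n) x := by
    lift x to 𝒢 d using hx
    simp [laxFlow]
  rw [h1, ConvMap.sum_apply, ConvMap.sum_apply]
  refine Finset.sum_subset (by simpa using hN) fun n _ hn => ?_
  change (t : ℂ) ^ n • laxCoeff k L₀ n x = 0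
  rw [laxCoeff_apply_eq_zero h𝒢 k h n d (by simpa using hn) x hx, smul_zero]

theorem exists_laxFlow_apply (h𝒢 : IsConnectedGradedHopf 𝒢) (k : ℤ) {L₀ : ConvMap H Laurent}
    (h : L₀ 1 = 0) (x : H) : ∃ N₀, ∀ N ≥ N₀, ∀ t : ℝ,
      laxFlow 𝒢 k L₀ t x = (∑ n ∈ Finset.range N, (t : ℂ) ^ n • laxCoeff k L₀ n) x := by
  induction x using DirectSum.Decomposition.inductionOn 𝒢 with
  | zero => exact ⟨0, fun N _ t => by simp⟩
  | @homogeneous d x => exact ⟨d, fun N hN t => laxFlow_apply h𝒢 k h t hN x.2⟩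
  | add x y hx hy =>
    obtain ⟨N₁, h₁⟩ := hx
    obtain ⟨N₂, h₂⟩ := hy
    exact ⟨max N₁ N₂, fun N hN t => by
      rw [map_add, map_add, h₁ N (le_trans (le_max_left _ _) hN),
        h₂ N (le_trans (le_max_right _ _) hN)]⟩

theorem laxFlow_infinitesimal (h𝒢 : IsConnectedGradedHopf 𝒢) (k : ℤ) {L₀ : ConvMap H Laurent}
    (h : IsInfinitesimalCharacter L₀) (t : ℝ) :
    IsInfinitesimalCharacter (laxFlow 𝒢 k L₀ t) := by
  intro x y
  obtain ⟨N₁, h₁⟩ := exists_laxFlow_apply h𝒢 k h.map_one x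
  obtain ⟨N₂, h₂⟩ := exists_laxFlow_apply h𝒢 k h.map_one y
  obtain ⟨N₃, h₃⟩ := exists_laxFlow_apply h𝒢 k h.map_one (x * y)
  rw [h₁ (N₁ + N₂ + N₃) (by omega), h₂ (N₁ + N₂ + N₃) (by omega), h₃ (N₁ + N₂ + N₃) (by omega)]
  exact IsInfinitesimalCharacter.sum
    (fun n _ => (laxCoeff_infinitesimal k h n).smul ((t : ℂ) ^ n)) x y

theorem laxFlow_holomorphic (h𝒢 : IsConnectedGradedHopf 𝒢) (k : ℤ) {L₀ : ConvMap H Laurent}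
    (h1 : L₀ 1 = 0) (h : ∀ x, mulLam 1 L₀ x ∈ holomorphic) (t : ℝ) (x : H) :
    mulLam 1 (laxFlow 𝒢 k L₀ t) x ∈ holomorphic := by
  obtain ⟨N, hN⟩ := exists_laxFlow_apply h𝒢 k h1 x
  rw [mulLam_apply, hN N le_rfl, ConvMap.sum_apply, Finset.mul_sum]
  refine sum_mem fun n _ => ?_
  change lam 1 * ((t : ℂ) ^ n • laxCoeff k L₀ n x) ∈ _
  rw [mul_smul_comm]
  exact holomorphic.smul_mem (laxCoeff_holomorphic k h n x) _

theorem laxFlow_zero (h𝒢 : IsConnectedGradedHopf 𝒢) (k : ℤ) {L₀ : ConvMap H Laurent}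
    (h : L₀ 1 = 0) : laxFlow 𝒢 k L₀ 0 = L₀ := by
  refine ConvMap.ext_apply fun x => ?_
  obtain ⟨N, hN⟩ := exists_laxFlow_apply h𝒢 k h x
  rw [hN (N + 1) (by omega), Finset.sum_range_succ']
  simp [laxCoeff_zero]

theorem hasLaurentDerivAt_sum_pow_smul (N : ℕ) (c : ℕ → Laurent) (t : ℝ) :
    HasLaurentDerivAt (fun s : ℝ => ∑ n ∈ Finset.range (N + 1), (s : ℂ) ^ n • c n)
      (∑ n ∈ Finset.range N, (t : ℂ) ^ n • ((n : ℂ) + 1) • c (n + 1)) t := by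
  intro j
  have h : HasDerivAt (fun s : ℝ => ∑ n ∈ Finset.range (N + 1), (s : ℂ) ^ n * (c n).coeff j)
      (∑ n ∈ Finset.range (N + 1), (n * (t : ℂ) ^ (n - 1)) * (c n).coeff j) t :=
    HasDerivAt.fun_sum fun n _ => ((hasDerivAt_pow n (t : ℂ)).comp_ofReal).mul_const _
  simp only [coeff_sum, coeff_smul]
  refine h.congr_deriv ?_
  rw [Finset.sum_range_succ']
  simp only [Nat.cast_zero, zero_mul, add_zero]
  refine Finset.sum_congr rfl fun n _ => ?_
  push_cast
  ring

theorem laxFlow_equation (h𝒢 : IsConnectedGradedHopf 𝒢) (k : ℤ) {L₀ : ConvMap H Laurent}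
    (h1 : L₀ 1 = 0) (t : ℝ) (x : H) :
    HasLaurentDerivAt (fun s : ℝ => laxFlow 𝒢 k L₀ s x)
      (⁅laxFlow 𝒢 k L₀ t, rOp (mulLam k (laxFlow 𝒢 k L₀ t))⁆ x) t := by
  induction x using DirectSum.Decomposition.inductionOn 𝒢 with
  | zero => simpa using HasLaurentDerivAt.const 0 t
  | add x y hx hy => simpa only [map_add] using hx.add hy
  | @homogeneous d x =>
    -- One term more than needed is kept, so that the derivative runs over `n < d` and matches the
    -- Cauchy product below.
    have hL : ∀ s : ℝ, laxFlow 𝒢 k L₀ s (x : H) =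
        ∑ n ∈ Finset.range (d + 1), (s : ℂ) ^ n • laxCoeff k L₀ n x := by
      intro s
      rw [laxFlow_apply h𝒢 k h1 s d.le_succ x.2, ConvMap.sum_apply]
      rfl
    simp only [hL]
    have hd := hasLaurentDerivAt_sum_pow_smul d (fun n => laxCoeff k L₀ n x) t
    convert hd using 1
    set F : ConvMap H Laurent := ∑ n ∈ Finset.range (d + 1), (t : ℂ) ^ n • laxCoeff k L₀ n with hF
    have e1 : ∀ e ≤ d, ∀ y ∈ 𝒢 e, laxFlow 𝒢 k L₀ t y = F y := fun e he y hy =>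
      laxFlow_apply h𝒢 k h1 t (by omega) hy
    have e2 : ∀ e ≤ d, ∀ y ∈ 𝒢 e, laxOp k (laxFlow 𝒢 k L₀ t) y = laxOp k F y := by
      intro e he y hy
      exact congrArg ((projPlus - projMinus) ∘ₗ LinearMap.mulLeft ℂ (lam k)) (e1 e he y hy)
    have e3 : ⁅laxFlow 𝒢 k L₀ t, laxOp k (laxFlow 𝒢 k L₀ t)⁆ (x : H) = ⁅F, laxOp k F⁆ x := by
      rw [ConvMap.lie_apply, ConvMap.lie_apply, ConvMap.mul_congr h𝒢 e1 e2 x.2,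
        ConvMap.mul_congr h𝒢 e2 e1 x.2]
    refine e3.trans ?_
    have e4 : laxOp k F = ∑ n ∈ Finset.range (d + 1), (t : ℂ) ^ n • laxOp k (laxCoeff k L₀ n) :=
      ConvMap.post_sum_smul ((projPlus - projMinus) ∘ₗ LinearMap.mulLeft ℂ (lam k)) _ _ _
    have e5 : ⁅F, laxOp k F⁆ (x : H) = ∑ i ∈ Finset.range (d + 1), ∑ j ∈ Finset.range (d + 1),
        (t : ℂ) ^ (i + j) • ⁅laxCoeff k L₀ i, laxOp k (laxCoeff k L₀ j)⁆ (x : H) := by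
      have e6 : ∀ f g : ℕ → ConvMap H Laurent,
          (∑ n ∈ Finset.range (d + 1), (t : ℂ) ^ n • f n) *
            (∑ n ∈ Finset.range (d + 1), (t : ℂ) ^ n • g n) =
          ∑ i ∈ Finset.range (d + 1), ∑ j ∈ Finset.range (d + 1),
            (t : ℂ) ^ (i + j) • (f i * g j) := by
        intro f g
        rw [Finset.sum_mul_sum]
        refine Finset.sum_congr rfl fun i _ => Finset.sum_congr rfl fun j _ => ?_
        rw [smul_mul_assoc, mul_smul_comm, smul_smul, pow_add]
      rw [e4, hF, Ring.lie_def, e6, e6, Finset.sum_comm (f := fun i j =>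
        (t : ℂ) ^ (i + j) • (laxOp k (laxCoeff k L₀ i) * laxCoeff k L₀ j)),
        ← Finset.sum_sub_distrib, ConvMap.sum_apply]
      refine Finset.sum_congr rfl fun i _ => ?_
      rw [← Finset.sum_sub_distrib, ConvMap.sum_apply]
      refine Finset.sum_congr rfl fun j _ => ?_
      rw [add_comm j i, ← smul_sub, ← Ring.lie_def]
      rfl
    -- Brackets with `i + j ≥ d` vanish in degree `d`; the others group into the recursion for the
    -- coefficients.
    rw [e5, Finset.sum_range_range_eq_sum_antidiagonal _ d.le_succ]
    · refine Finset.sum_congr rfl fun n _ => ?_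
      have e6 := congrArg (fun f : ConvMap H Laurent => f (x : H)) (succ_smul_laxCoeff k L₀ n)
      change ((n : ℂ) + 1) • laxCoeff k L₀ (n + 1) x = _ at e6
      rw [e6, ConvMap.sum_apply, Finset.smul_sum]
      refine Finset.sum_congr rfl fun p hp => ?_
      rw [Finset.HasAntidiagonal.mem_antidiagonal.1 hp]
    · intro i j hij
      have h0 := laxCoeff_apply_eq_zero h𝒢 k h1 i
      have h0' : ∀ e ≤ j, ∀ y ∈ 𝒢 e, laxOp k (laxCoeff k L₀ j) y = 0 := by
        intro e he y hy
        rw [laxOp_eq_post]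
        change ((projPlus - projMinus) ∘ₗ LinearMap.mulLeft ℂ (lam k)) (laxCoeff k L₀ j y) = 0
        rw [laxCoeff_apply_eq_zero h𝒢 k h1 j e he y hy, map_zero]
      rw [ConvMap.lie_apply, ConvMap.mul_apply_eq_zero h𝒢 h0 h0' (by omega) x.2,
        ConvMap.mul_apply_eq_zero h𝒢 h0' h0 (by omega) x.2, sub_zero, smul_zero]

theorem isLaxFlow_laxFlow (h𝒢 : IsConnectedGradedHopf 𝒢) (k : ℤ) {L₀ : ConvMap H Laurent}
    (h : IsInfinitesimalCharacter L₀) : IsLaxFlow k L₀ (laxFlow 𝒢 k L₀) :=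
  ⟨laxFlow_zero h𝒢 k h.map_one, laxFlow_infinitesimal h𝒢 k h, laxFlow_equation h𝒢 k h.map_one⟩

/-- By induction on the degree both flows have the same derivative there, and they agree at t = 0;
no estimate is needed. -/
theorem IsLaxFlow.unique (h𝒢 : IsConnectedGradedHopf 𝒢) {k : ℤ} {L₀ : ConvMap H Laurent}
    {L L' : ℝ → ConvMap H Laurent} (hL : IsLaxFlow k L₀ L) (hL' : IsLaxFlow k L₀ L') : L = L' := by
  have key : ∀ n, ∀ x ∈ 𝒢 n, ∀ t, L t x = L' t x := by
    intro n
    induction n using Nat.strong_induction_on with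
    | _ n ih =>
    intro x hx t
    have hbr : ∀ t, ⁅L t, laxOp k (L t)⁆ x = ⁅L' t, laxOp k (L' t)⁆ x := by
      intro t
      have h1 := (hL.infinitesimal t).map_one
      have h1' := (hL'.infinitesimal t).map_one
      have h2 : laxOp k (L t) 1 = 0 := ((hL.infinitesimal t).mulLam k).rOp.map_one
      have h2' : laxOp k (L' t) 1 = 0 := ((hL'.infinitesimal t).mulLam k).rOp.map_one
      have e1 : ∀ e < n, ∀ y ∈ 𝒢 e, L t y = L' t y := fun e he y hy => ih e he y hy t
      have e2 : ∀ e < n, ∀ y ∈ 𝒢 e, laxOp k (L t) y = laxOp k (L' t) y := by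
        intro e he y hy
        exact congrArg ((projPlus - projMinus) ∘ₗ LinearMap.mulLeft ℂ (lam k)) (e1 e he y hy)
      rw [ConvMap.lie_apply, ConvMap.lie_apply,
        ConvMap.mul_congr_of_lt h𝒢 h1 h1' h2 h2' e1 e2 hx,
        ConvMap.mul_congr_of_lt h𝒢 h2 h2' h1 h1' e2 e1 hx]
    refine Laurent.ext fun j => ?_
    have hd : ∀ s, HasDerivAt (fun s => (L s x).coeff j - (L' s x).coeff j) 0 s := by
      intro s
      have h1 := hL.equation s x j
      have h2 := hL'.equation s x j
      refine (h1.sub h2).congr_deriv ?_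
      exact sub_eq_zero.2 (congrArg (fun a : Laurent => a.coeff j) (hbr s))
    have := is_const_of_deriv_eq_zero (fun s => (hd s).differentiableAt)
      (fun s => (hd s).deriv) t 0
    simp only [hL.init, hL'.init, sub_self] at this
    exact sub_eq_zero.1 this
  exact funext fun t => ConvMap.ext_homogeneous fun n x hx => key n x hx t

/-- For `k ≥ 1` the Lax flow is constant, since `λ ^ k L₀` is holomorphic. -/
theorem isLaxFlow_const {k : ℤ} (hk : 1 ≤ k) {L₀ : ConvMap H Laurent}
    (hL₀ : IsInfinitesimalCharacter L₀) (h : ∀ x, mulLam 1 L₀ x ∈ holomorphic) :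
    IsLaxFlow k L₀ (fun _ => L₀) := by
  refine ⟨rfl, fun _ => hL₀, fun t x => ?_⟩
  have h1 : plusLam k L₀ = mulLam k L₀ := by
    refine ConvMap.ext_apply fun x => ?_
    have h2 : mulLam k L₀ x ∈ holomorphic := by
      have := mul_mem (lam_mem_holomorphic (sub_nonneg.2 hk)) (h x)
      rwa [← mulLam_apply, mulLam_mulLam, sub_add_cancel] at this
    have h3 := projMinus_add_projPlus (mulLam k L₀ x)
    rwa [mem_holomorphic_iff_projMinus.1 h2, zero_add] at h3
  have h2 : ⁅L₀, laxOp k L₀⁆ = 0 := by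
    rw [lie_laxOp_self, h1, Ring.lie_def, mul_mulLam, mulLam_mul, sub_self, smul_zero]
  change HasLaurentDerivAt (fun _ : ℝ => L₀ x) (⁅L₀, laxOp k L₀⁆ x) t
  rw [h2]
  exact HasLaurentDerivAt.const _ _

end Hopf

/-! ### Curves polynomial in t -/

/-- Curves of Laurent series that are polynomial in the parameter. -/
def IsPolyCurve (f : ℝ → Laurent) : Prop :=
  ∃ p : Polynomial Laurent, ∀ t : ℝ, f t = p.eval (algebraMap ℂ Laurent (t : ℂ))

namespace IsPolyCurve

theorem const (a : Laurent) : IsPolyCurve fun _ => a := ⟨Polynomial.C a, fun _ => by simp⟩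

theorem add {f g : ℝ → Laurent} (hf : IsPolyCurve f) (hg : IsPolyCurve g) :
    IsPolyCurve fun t => f t + g t := by
  obtain ⟨p, hp⟩ := hf
  obtain ⟨q, hq⟩ := hg
  exact ⟨p + q, fun t => by simp only [hp, hq, Polynomial.eval_add]⟩

theorem mul {f g : ℝ → Laurent} (hf : IsPolyCurve f) (hg : IsPolyCurve g) :
    IsPolyCurve fun t => f t * g t := by
  obtain ⟨p, hp⟩ := hf
  obtain ⟨q, hq⟩ := hg
  exact ⟨p * q, fun t => by simp only [hp, hq, Polynomial.eval_mul]⟩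

theorem sum {ι : Type*} {s : Finset ι} {f : ι → ℝ → Laurent}
    (hf : ∀ i ∈ s, IsPolyCurve (f i)) : IsPolyCurve fun t => ∑ i ∈ s, f i t := by
  classical
  induction s using Finset.induction_on with
  | empty => simpa using const 0
  | insert i s hi ih =>
    simp only [Finset.sum_insert hi]
    exact (hf i (Finset.mem_insert_self i s)).add
      (ih fun j hj => hf j (Finset.mem_insert_of_mem hj))

theorem pow_smul (n : ℕ) (a : Laurent) : IsPolyCurve fun t : ℝ => (t : ℂ) ^ n • a :=
  ⟨Polynomial.monomial n a, fun t => by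
    simp only [Polynomial.eval_monomial, ← map_pow, Algebra.smul_def, mul_comm]⟩

theorem induction {f : ℝ → Laurent} (hf : IsPolyCurve f) {P : (ℝ → Laurent) → Prop}
    (hadd : ∀ f g, P f → P g → P fun t => f t + g t)
    (hmon : ∀ (n : ℕ) (a : Laurent), P fun t : ℝ => (t : ℂ) ^ n • a) : P f := by
  obtain ⟨p, hp⟩ := hf
  rw [funext hp]
  clear hp
  induction p using Polynomial.induction_on' with
  | add p q hp hq => simpa only [Polynomial.eval_add] using hadd _ _ hp hq
  | monomial n a =>
    convert hmon n a using 2 with t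
    rw [Polynomial.eval_monomial, ← map_pow, Algebra.smul_def, mul_comm]

/-- The parameter enters through complex scalars, so ℂ-linearity of `P` is enough; this covers the
pole projection, which is not multiplicative. -/
theorem map {f : ℝ → Laurent} (hf : IsPolyCurve f) (P : Laurent →ₗ[ℂ] Laurent) :
    IsPolyCurve fun t => P (f t) := by
  refine hf.induction (P := fun f => IsPolyCurve fun t => P (f t)) (fun f g hf hg => ?_)
    fun n a => ?_
  · simpa only [map_add] using hf.add hg
  · simpa only [map_smul] using pow_smul n (P a)

theorem differentiable_coeff {f : ℝ → Laurent} (hf : IsPolyCurve f) (j : ℤ) :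
    Differentiable ℝ fun t => (f t).coeff j := by
  refine hf.induction (P := fun f => Differentiable ℝ fun t => (f t).coeff j)
    (fun f g hf hg => hf.add hg) fun n a t => ?_
  have h : HasDerivAt (fun s : ℝ => (s : ℂ) ^ n * a.coeff j) _ t :=
    ((hasDerivAt_pow n (t : ℂ)).comp_ofReal).mul_const _
  exact h.differentiableAt

end IsPolyCurve

/-! ### Residues, smoothness of the Birkhoff factors and the evolution of β -/

section Hopf
variable {H : Type*} [CommRing H] [HopfAlgebra ℂ H]

theorem isPolyCurve_mul {f g : ℝ → ConvMap H Laurent} (hf : ∀ x, IsPolyCurve fun t => f t x)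
    (hg : ∀ x, IsPolyCurve fun t => g t x) (x : H) : IsPolyCurve fun t => (f t * g t) x := by
  simp only [(Coalgebra.Repr.arbitrary ℂ x).convMul_apply]
  exact IsPolyCurve.sum fun i _ => (hf _).mul (hg _)

theorem hasDerivAt_convMul {f g : ℝ → ConvMap H ℂ} {f' g' : ConvMap H ℂ} {t : ℝ}
    (hf : ∀ x, HasDerivAt (fun s => f s x) (f' x) t)
    (hg : ∀ x, HasDerivAt (fun s => g s x) (g' x) t) (x : H) :
    HasDerivAt (fun s => (f s * g s) x) ((f' * g t + f t * g') x) t := by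
  simp only [(Coalgebra.Repr.arbitrary ℂ x).convMul_apply]
  have h : HasDerivAt (fun s => ∑ i ∈ (Coalgebra.Repr.arbitrary ℂ x).index,
      f s ((Coalgebra.Repr.arbitrary ℂ x).left i) * g s ((Coalgebra.Repr.arbitrary ℂ x).right i))
      _ t := HasDerivAt.fun_sum fun i _ => (hf _).mul (hg _)
  refine h.congr_deriv ?_
  change _ = (f' * g t) x + (f t * g') x
  rw [(Coalgebra.Repr.arbitrary ℂ x).convMul_apply, (Coalgebra.Repr.arbitrary ℂ x).convMul_apply,
    Finset.sum_add_distrib]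

/-- The derivative of a curve of functionals that is differentiable at each element. -/
theorem exists_hasDerivAt {f : ℝ → ConvMap H ℂ} {t : ℝ}
    (hf : ∀ x, DifferentiableAt ℝ (fun s => f s x) t) :
    ∃ f' : ConvMap H ℂ, ∀ x, HasDerivAt (fun s => f s x) (f' x) t := by
  refine ⟨WithConv.toConv
    { toFun := fun x => deriv (fun s => f s x) t
      map_add' := fun x y => ?_
      map_smul' := fun c x => ?_ }, fun x => (hf x).hasDerivAt⟩
  · simp only [map_add]
    exact ((hf x).hasDerivAt.add (hf y).hasDerivAt).deriv
  · simp only [map_smul, smul_eq_mul, RingHom.id_apply]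
    exact ((hf x).hasDerivAt.const_mul c).deriv

theorem atZero_mulLam_one (f : ConvMap H Laurent) : atZero (mulLam 1 f) = residue f :=
  ConvMap.ext_apply fun x => coeff_lam_mul 1 (f x) 0

theorem residue_mul {f g : ConvMap H Laurent} (hf : ∀ x, projPlus (f x) = 0)
    (hg : ∀ x, g x ∈ polar) : residue (f * g) = residue f * atZero g := by
  refine ConvMap.ext_apply fun x => ?_
  refine Eq.trans ?_ ((Coalgebra.Repr.arbitrary ℂ x).convMul_apply (residue f) (atZero g)).symm
  change ((f * g) x).coeff (-1) = _
  rw [(Coalgebra.Repr.arbitrary ℂ x).convMul_apply, coeff_sum]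
  exact Finset.sum_congr rfl fun i _ => coeff_neg_one_mul_of_mem_polar (hf _) (hg _)

theorem atZero_mulLam_one_of_holomorphic {f : ConvMap H Laurent} (hf : ∀ x, f x ∈ holomorphic) :
    atZero (mulLam 1 f) = 0 := by
  rw [atZero_mulLam_one]
  exact ConvMap.ext_apply fun x => mem_holomorphic_iff.1 (hf x) _ (by norm_num)

/-- The residue is the value at λ = 0 of the commutator of the holomorphic maps λZ and P₊(λ^k Z).
The shift k - 2 appears because the constant term of λ^k Z is the residue of λ^(k-2) · λZ. -/
theorem residue_lie_laxOp {Z : ConvMap H Laurent} (hZ : ∀ x, mulLam 1 Z x ∈ holomorphic) (k : ℤ) :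
    residue ⁅Z, laxOp k Z⁆ =
      (2 : ℂ) • ⁅residue Z, residue (mulLam (k - 2) (mulLam 1 Z))⁆ := by
  have hP := plusLam_mem_holomorphic k Z
  have h1 : residue (mulLam (k - 2) (mulLam 1 Z)) = atZero (plusLam k Z) := by
    refine ConvMap.ext_apply fun x => ?_
    change (lam (k - 2) * (lam 1 * Z x)).coeff (-1) = (projPlus (lam k * Z x)).coeff 0
    rw [coeff_projPlus, if_neg (lt_irrefl 0), coeff_lam_mul, coeff_lam_mul, coeff_lam_mul]
    congr 1
    ring
  have h2 : mulLam 1 ⁅Z, plusLam k Z⁆ = mulLam 1 Z * plusLam k Z - plusLam k Z * mulLam 1 Z := by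
    rw [mulLam_mul, mul_mulLam, Ring.lie_def]
    exact ConvMap.ext_apply fun x => mul_sub _ _ _
  have h3 : residue ⁅Z, plusLam k Z⁆ = ⁅residue Z, atZero (plusLam k Z)⁆ := by
    rw [← atZero_mulLam_one, h2, Ring.lie_def, ← atZero_mulLam_one Z,
      ← atZero_mul_of_holomorphic hZ hP, ← atZero_mul_of_holomorphic hP hZ]
    exact ConvMap.ext_apply fun x => rfl
  rw [lie_laxOp_self, h1, ← h3]
  exact ConvMap.ext_apply fun x => rfl

theorem mul_scalarInv_atZero {v : Character H} (hv : ∀ x, v x ∈ holomorphic) :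
    atZero v.toConvMap * scalarInv (atZero v.toConvMap) = 1 := by
  rw [← atZero_inv, ← atZero_mul_of_holomorphic hv fun x => hv _, Character.toConvMap_mul_inv,
    atZero_one]

theorem scalarInv_atZero_mul {v : Character H} (hv : ∀ x, v x ∈ holomorphic) :
    scalarInv (atZero v.toConvMap) * atZero v.toConvMap = 1 := by
  rw [← atZero_inv, ← atZero_mul_of_holomorphic (fun x => hv _) hv, Character.toConvMap_inv_mul,
    atZero_one]

/-- The derivative of a conjugate `g X g⁻¹` of a curve `X` with `X' = 2 [X, ρ]`. -/
theorem conj_derivative_eq {A : Type*} [Ring A] [Algebra ℂ A] {g G D E X ρ : A}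
    (hGg : G * g = 1) (hE : D * G + g * E = 0) :
    (D * X + g * ((2 : ℂ) • (X * ρ - ρ * X))) * G + g * X * E =
      g * X * G * (-(D * G) + (2 : ℂ) • (g * ρ * G)) -
        (-(D * G) + (2 : ℂ) • (g * ρ * G)) * (g * X * G) := by
  have hE' : E = -(G * D * G) := by
    have h : G * (D * G + g * E) = 0 := by rw [hE, mul_zero]
    rw [mul_add, ← mul_assoc, ← mul_assoc, hGg, one_mul] at h
    exact eq_neg_of_add_eq_zero_right h
  have e1 : g * X * G * (g * ρ * G) = g * X * ρ * G := by
    calc g * X * G * (g * ρ * G) = g * X * (G * g) * ρ * G := by noncomm_ring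
      _ = _ := by rw [hGg, mul_one]
  have e2 : g * ρ * G * (g * X * G) = g * ρ * X * G := by
    calc g * ρ * G * (g * X * G) = g * ρ * (G * g) * X * G := by noncomm_ring
      _ = _ := by rw [hGg, mul_one]
  have e3 : D * G * (g * X * G) = D * X * G := by
    calc D * G * (g * X * G) = D * (G * g) * X * G := by noncomm_ring
      _ = _ := by rw [hGg, mul_one]
  rw [mul_add, add_mul (-(D * G)), mul_smul_comm 2 (g * X * G), smul_mul_assoc 2 (g * ρ * G), e1,
    e2, neg_mul, e3, hE']
  simp only [two_smul]
  noncomm_ring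

variable {𝒢 : ℕ → Submodule ℂ H} [GradedAlgebra 𝒢]

theorem isPolyCurve_of_homogeneous {f : ℝ → ConvMap H Laurent}
    (hf : ∀ d, ∀ x ∈ 𝒢 d, IsPolyCurve fun t => f t x) (x : H) : IsPolyCurve fun t => f t x := by
  induction x using DirectSum.Decomposition.inductionOn 𝒢 with
  | zero => simpa using IsPolyCurve.const 0
  | add x y hx hy => simpa only [map_add] using hx.add hy
  | homogeneous x => exact hf _ _ x.2

theorem isPolyCurve_laxFlow (h𝒢 : IsConnectedGradedHopf 𝒢) (k : ℤ) {L₀ : ConvMap H Laurent}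
    (h : L₀ 1 = 0) (x : H) : IsPolyCurve fun t => laxFlow 𝒢 k L₀ t x := by
  obtain ⟨N, hN⟩ := exists_laxFlow_apply h𝒢 k h x
  simp only [hN N le_rfl, ConvMap.sum_apply]
  exact IsPolyCurve.sum fun n _ => IsPolyCurve.pow_smul n _

theorem isPolyCurve_of_rTilde (h𝒢 : IsConnectedGradedHopf 𝒢) {φ : ℝ → Character H}
    (h : ∀ x, IsPolyCurve fun t => rTilde 𝒢 (φ t) x) (x : H) : IsPolyCurve fun t => φ t x := by
  refine isPolyCurve_of_homogeneous (𝒢 := 𝒢) (f := fun t => (φ t).toConvMap) (fun d => ?_) x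
  induction d using Nat.strong_induction_on with
  | _ d ih =>
  intro x hx
  simp only [Character.toConvMap_apply]
  rcases Nat.eq_zero_or_pos d with rfl | hd
  · rw [h𝒢.eq_smul_one hx]
    simpa using IsPolyCurve.const _
  have hd' : (d : ℂ) ≠ 0 := by exact_mod_cast hd.ne'
  obtain ⟨s, hs, hsum⟩ := h𝒢.exists_comul_eq_add hx
  have e : ∀ t, φ t x = ((d : ℂ)⁻¹ • LinearMap.id (R := ℂ) (M := Laurent))
      (∑ i ∈ s, (φ t).toConvMap i.2.1 * rTilde 𝒢 (φ t) i.2.2) := by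
    intro t
    have h1 := rTilde_apply_homogeneous (φ := φ t) hx
    rw [ConvMap.mul_apply_of_comul_add _ _ hsum, (rTilde_infinitesimal (φ t)).map_one, mul_zero,
      zero_add] at h1
    rw [← h1, LinearMap.smul_apply, LinearMap.id_apply, smul_smul, inv_mul_cancel₀ hd', one_smul]
  simp only [e]
  refine IsPolyCurve.map (IsPolyCurve.sum fun i hi => ?_) _
  have := hs i hi
  exact (ih i.1.1 (by omega) _ i.2.1.2).mul (h _)

theorem plusPart_eq (h𝒢 : IsConnectedGradedHopf 𝒢) (φ : Character H) :
    plusPart φ = minusPart φ * φ := by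
  have h := (isBirkhoff_birkhoff h𝒢 φ).eq
  rw [eq_inv_mul_iff_mul_eq] at h
  exact h.symm

/-- Bogoliubov's recursion φ₋(x) = -P₋(∑ φ₋(a) φ(b)) expresses the factor through lower degrees by
operations that preserve polynomial curves. -/
theorem isPolyCurve_minusPart (h𝒢 : IsConnectedGradedHopf 𝒢) {φ : ℝ → Character H}
    (h : ∀ x, IsPolyCurve fun t => φ t x) (x : H) :
    IsPolyCurve fun t => minusPart (φ t) x := by
  refine isPolyCurve_of_homogeneous (𝒢 := 𝒢) (f := fun t => (minusPart (φ t)).toConvMap)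
    (fun d => ?_) x
  induction d using Nat.strong_induction_on with
  | _ d ih =>
  intro x hx
  simp only [Character.toConvMap_apply]
  rcases Nat.eq_zero_or_pos d with rfl | hd
  · rw [h𝒢.eq_smul_one hx]
    simpa using IsPolyCurve.const _
  obtain ⟨s, hs, hsum⟩ := h𝒢.exists_comul_eq_add hx
  have e : ∀ t, minusPart (φ t) x = (-projMinus)
      (∑ i ∈ s, (minusPart (φ t)).toConvMap i.2.1 * (φ t).toConvMap i.2.2) := by
    intro t
    have hb := isBirkhoff_birkhoff h𝒢 (φ t)
    have h1 : projPlus (minusPart (φ t) x) = 0 := hb.minus x (h𝒢.counit_eq_zero d hd.ne' x hx)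
    have h2 : projMinus (plusPart (φ t) x) = 0 := hb.plus x
    have h3 : plusPart (φ t) x = ((minusPart (φ t)).toConvMap * (φ t).toConvMap) x := by
      rw [plusPart_eq h𝒢]; rfl
    rw [h3, ConvMap.mul_apply_of_comul_add _ _ hsum, map_add] at h2
    have h4 := projMinus_add_projPlus (minusPart (φ t) x)
    rw [h1, add_zero] at h4
    rw [Character.toConvMap_apply, Character.toConvMap_apply, map_one, mul_one, h4] at h2
    rw [LinearMap.neg_apply]
    exact eq_neg_of_add_eq_zero_left h2
  simp only [e]
  refine IsPolyCurve.map (IsPolyCurve.sum fun i hi => ?_) _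
  have := hs i hi
  exact (ih i.1.1 (by omega) _ i.2.1.2).mul (h _)

theorem isPolyCurve_plusPart (h𝒢 : IsConnectedGradedHopf 𝒢) {φ : ℝ → Character H}
    (h : ∀ x, IsPolyCurve fun t => φ t x) (x : H) :
    IsPolyCurve fun t => plusPart (φ t) x := by
  simp only [plusPart_eq h𝒢]
  exact isPolyCurve_mul (f := fun t => (minusPart (φ t)).toConvMap)
    (g := fun t => (φ t).toConvMap) (isPolyCurve_minusPart h𝒢 h) h x

theorem betaFunction_apply (φ : Character H) (x : H) :
    betaFunction 𝒢 φ x = -(minusPart φ (gradingY 𝒢 x)).coeff (-1) := rfl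

theorem betaFunction_infinitesimal (h𝒢 : IsConnectedGradedHopf 𝒢) (φ : Character H) :
    IsInfinitesimalCharacter (betaFunction 𝒢 φ) := by
  intro x y
  have hb := isBirkhoff_birkhoff h𝒢 φ
  have hY : ∀ z, projPlus (minusPart φ (gradingY 𝒢 z)) = 0 := fun z =>
    hb.minus _ (counit_gradingY h𝒢 z)
  have h0 : ∀ z, (minusPart φ z).coeff 0 = counit (R := ℂ) z := fun z =>
    congrArg (fun f : ConvMap H ℂ => f z) hb.atZero_minus
  rw [betaFunction_apply, betaFunction_apply, betaFunction_apply, gradingY_mul, map_add, map_mul,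
    map_mul, coeff_add, coeff_neg_one_mul_of_mem_polar (hY x) (hb.polar_minus y), h0,
    mul_comm (minusPart φ x), coeff_neg_one_mul_of_mem_polar (hY y) (hb.polar_minus x), h0]
  simp only [Algebra.algebraMap_self, RingHom.id_apply]
  ring

/-- For a local character `β_φ = Ad(φ₊(0)) (β̃_φ(0))`, where `β̃_φ = λ R̃(φ)`. -/
theorem betaFunction_eq_adScalar (h𝒢 : IsConnectedGradedHopf 𝒢) {φ : Character H}
    (h : ∀ x, mulLam 1 (rTilde 𝒢 φ) x ∈ holomorphic) :
    betaFunction 𝒢 φ =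
      adScalar (atZero (plusPart φ).toConvMap) (residue (rTilde 𝒢 φ)) := by
  have hb := isBirkhoff_birkhoff h𝒢 φ
  set u := minusPart φ
  set v := plusPart φ
  set Z := rTilde 𝒢 φ
  have hv : v.toConvMap = u.toConvMap * φ.toConvMap := by
    rw [← Character.toConvMap_mul, ← plusPart_eq h𝒢]
  have hφ : φ.toConvMap = (u⁻¹).toConvMap * v.toConvMap := by
    rw [hv, ← mul_assoc, Character.toConvMap_inv_mul, one_mul]
  -- Leibniz rule for `Y` on φ₊ = φ₋ ⋆ φ. After right multiplication by φ₊⁻¹ the left side is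
  -- holomorphic, the first summand has residue -β_φ, and the last gives the adjoint action.
  have e1 : v.toConvMap.compY 𝒢 = u.toConvMap.compY 𝒢 * φ.toConvMap + v.toConvMap * Z := by
    conv_lhs => rw [hv]
    rw [ConvMap.compY_mul h𝒢, rTilde_eq_iff.1 (rfl : rTilde 𝒢 φ = Z), ← mul_assoc, ← hv]
  have e2 : v.toConvMap.compY 𝒢 * (v⁻¹).toConvMap =
      u.toConvMap.compY 𝒢 * (u⁻¹).toConvMap + v.toConvMap * Z * (v⁻¹).toConvMap := by
    rw [e1, add_mul]
    congr 1
    rw [hφ, mul_assoc, mul_assoc, Character.toConvMap_mul_inv, mul_one]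
  have hvi : ∀ x, (v⁻¹).toConvMap x ∈ holomorphic := fun x => hb.plus _
  have e3 : residue (v.toConvMap.compY 𝒢 * (v⁻¹).toConvMap) = 0 := by
    rw [← atZero_mulLam_one]
    exact atZero_mulLam_one_of_holomorphic (ConvMap.mul_mem _ (fun x => hb.plus _) hvi)
  have e4 : residue (u.toConvMap.compY 𝒢 * (u⁻¹).toConvMap) = -betaFunction 𝒢 φ := by
    rw [residue_mul (fun x => hb.minus _ (counit_gradingY h𝒢 x)) (fun x => hb.polar_minus _),
      atZero_inv, hb.atZero_minus, scalarInv_one, mul_one]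
    exact ConvMap.ext_apply fun x => (neg_neg ((u (gradingY 𝒢 x)).coeff (-1))).symm
  have e5 : residue (v.toConvMap * Z * (v⁻¹).toConvMap) =
      adScalar (atZero v.toConvMap) (residue Z) := by
    rw [← atZero_mulLam_one, ← mulLam_mul, ← mul_mulLam,
      atZero_mul_of_holomorphic (ConvMap.mul_mem _ hb.plus h) hvi,
      atZero_mul_of_holomorphic hb.plus h, atZero_mulLam_one]
    rfl
  have e6 := congrArg residue e2
  rw [e3] at e6
  have e7 : residue (u.toConvMap.compY 𝒢 * (u⁻¹).toConvMap + v.toConvMap * Z * (v⁻¹).toConvMap) =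
      residue (u.toConvMap.compY 𝒢 * (u⁻¹).toConvMap) +
        residue (v.toConvMap * Z * (v⁻¹).toConvMap) := ConvMap.ext_apply fun x => rfl
  rw [e7, e4, e5] at e6
  refine ConvMap.ext_apply fun x => ?_
  have := congrArg (fun f : ConvMap H ℂ => f x) e6
  change 0 = -betaFunction 𝒢 φ x + adScalar (atZero v.toConvMap) (residue Z) x at this
  linear_combination this

/-- The differential equation for the beta functions along the Lax flow. -/
theorem hasDerivAt_betaFunction (h𝒢 : IsConnectedGradedHopf 𝒢) (k : ℤ) {φ : ℝ → Character H}
    (hloc : ∀ t x, mulLam 1 (rTilde 𝒢 (φ t)) x ∈ holomorphic)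
    (hflow : ∀ t x, HasLaurentDerivAt (fun s : ℝ => rTilde 𝒢 (φ s) x)
      (⁅rTilde 𝒢 (φ t), laxOp k (rTilde 𝒢 (φ t))⁆ x) t)
    {D : ℝ → ConvMap H ℂ}
    (hD : ∀ t x, HasDerivAt (fun s => atZero (plusPart (φ s)).toConvMap x) (D t x) t)
    (t : ℝ) (x : H) :
    HasDerivAt (fun s => betaFunction 𝒢 (φ s) x)
      (⁅betaFunction 𝒢 (φ t), -(D t * scalarInv (atZero (plusPart (φ t)).toConvMap)) +
        (2 : ℂ) • adScalar (atZero (plusPart (φ t)).toConvMap)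
          (residue (mulLam (k - 2) (mulLam 1 (rTilde 𝒢 (φ t)))))⁆ x) t := by
  have hv : ∀ s x, plusPart (φ s) x ∈ holomorphic := fun s =>
    (isBirkhoff_birkhoff h𝒢 (φ s)).plus
  have hG : ∀ x, HasDerivAt (fun s => scalarInv (atZero (plusPart (φ s)).toConvMap) x)
      (scalarInv (D t) x) t := fun x => hD t (HopfAlgebra.antipode ℂ x)
  -- The inverse g ∘ S is differentiated as D ∘ S; differentiating g ⋆ g⁻¹ = 1 relates this to `D`.
  have hE : D t * scalarInv (atZero (plusPart (φ t)).toConvMap) +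
      atZero (plusPart (φ t)).toConvMap * scalarInv (D t) = 0 := by
    refine ConvMap.ext_apply fun x => ?_
    have h1 := hasDerivAt_convMul (hD t) hG x
    simp only [mul_scalarInv_atZero (hv _)] at h1
    exact h1.unique (hasDerivAt_const _ _)
  have hX : ∀ x, HasDerivAt (fun s => residue (rTilde 𝒢 (φ s)) x)
      (((2 : ℂ) • ⁅residue (rTilde 𝒢 (φ t)),
        residue (mulLam (k - 2) (mulLam 1 (rTilde 𝒢 (φ t))))⁆ : ConvMap H ℂ) x) t := by
    intro x
    rw [← residue_lie_laxOp (hloc t)]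
    exact hflow t x (-1)
  have key := hasDerivAt_convMul (hasDerivAt_convMul (hD t) hX) hG x
  have hβ : ∀ s, betaFunction 𝒢 (φ s) = atZero (plusPart (φ s)).toConvMap *
      residue (rTilde 𝒢 (φ s)) * scalarInv (atZero (plusPart (φ s)).toConvMap) := fun s =>
    betaFunction_eq_adScalar h𝒢 (hloc s)
  simp only [hβ]
  refine key.congr_deriv ?_
  rw [Ring.lie_def, Ring.lie_def, adScalar,
    ← conj_derivative_eq (scalarInv_atZero_mul (hv t)) hE]

end Hopf

end

/-! ### Assembly of the theorem -/

theorem theorem7p7 {H : Type*} [CommRing H] [HopfAlgebra ℂ H]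
    (𝒢 : ℕ → Submodule ℂ H) [GradedAlgebra 𝒢] (h𝒢 : IsConnectedGradedHopf 𝒢)
    (m n : ℤ) (φ : Character H) (hφ : IsLocalCharacter 𝒢 φ) :
    ∃ (L : ℝ → ConvMap H Laurent) (φt : ℝ → Character H) (B : ℝ → ConvMap H Laurent),
      -- `L` is the solution of the Lax pair equation with `L(0) = R̃(φ)`
      IsLaxFlow (-n + 2 * m) (rTilde 𝒢 φ) L ∧
      (∀ L', IsLaxFlow (-n + 2 * m) (rTilde 𝒢 φ) L' → L' = L) ∧
      -- `φt t` is the character `R̃⁻¹(L(t))`; it is local, so its beta function makes sense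
      (∀ (t : ℝ) (ψ : Character H), rTilde 𝒢 ψ = L t ↔ ψ = φt t) ∧
      (∀ t, ∃! p, IsBirkhoff (φt t) p) ∧
      (∀ t, IsLocalCharacter 𝒢 (φt t)) ∧
      (∀ t, IsBetaCharacter 𝒢 (φt t) (B t)) ∧
      (∀ t, IsInfinitesimalCharacter (betaFunction 𝒢 (φt t))) ∧
      -- the case `-n + 2m ≥ 1`
      (1 ≤ -n + 2 * m →
        ∀ t, φt t = φ ∧ betaFunction 𝒢 (φt t) = betaFunction 𝒢 φ) ∧
      -- the case `-n + 2m ≤ 0`; here `g t = (φ_t)₊(0)`, and `D t` is its derivative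
      (-n + 2 * m ≤ 0 →
        ∃ g D : ℝ → ConvMap H ℂ,
          (∀ t, g t = atZero (plusPart (φt t)).toConvMap) ∧
          (∀ t x, HasDerivAt (fun s => g s x) (D t x) t) ∧
          ∀ t x, HasDerivAt (fun s => betaFunction 𝒢 (φt s) x)
            (⁅betaFunction 𝒢 (φt t),
              -(D t * scalarInv (g t)) +
                (2 : ℂ) • adScalar (g t) (residue (mulLam (-n + 2 * m - 2) (B t)))⁆ x) t) := by
  set k := -n + 2 * m
  have hinf := rTilde_infinitesimal (𝒢 := 𝒢) φ
  have hhol := (isLocalCharacter_iff h𝒢).1 hφ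
  have hflow := isLaxFlow_laxFlow h𝒢 k hinf
  choose φt hφt using fun t => exists_rTilde_eq h𝒢 (laxFlow_infinitesimal h𝒢 k hinf t)
  have hloc : ∀ t x, mulLam 1 (rTilde 𝒢 (φt t)) x ∈ Laurent.holomorphic := fun t => by
    rw [hφt]; exact laxFlow_holomorphic h𝒢 k hinf.map_one hhol t
  refine ⟨laxFlow 𝒢 k (rTilde 𝒢 φ), φt, fun t => mulLam 1 (rTilde 𝒢 (φt t)), hflow,
    fun L' hL' => hL'.unique h𝒢 hflow, fun t ψ => ?_, fun t => ?_,
    fun t => (isLocalCharacter_iff h𝒢).2 (hloc t), fun t => isBetaCharacter_mulLam_rTilde h𝒢 _,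
    fun t => betaFunction_infinitesimal h𝒢 _, fun hk t => ?_, fun _ => ?_⟩
  · rw [← hφt t]
    exact (rTilde_injective h𝒢).eq_iff
  · exact ⟨_, isBirkhoff_birkhoff h𝒢 (φt t), fun q hq => hq.unique (isBirkhoff_birkhoff h𝒢 (φt t))⟩
  -- The constant curve also solves the equation, so uniqueness and injectivity of R̃ force `φt t =
  -- φ`.
  · have h1 := hflow.unique h𝒢 (isLaxFlow_const hk hinf hhol)
    have h2 : φt t = φ := rTilde_injective h𝒢 (by rw [hφt, h1])
    exact ⟨h2, by rw [h2]⟩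
  · have hpoly : ∀ x, IsPolyCurve fun t => φt t x := isPolyCurve_of_rTilde h𝒢 (by
      simp only [hφt]; exact isPolyCurve_laxFlow h𝒢 k hinf.map_one)
    choose D hD using fun t => exists_hasDerivAt
      (f := fun s => atZero (plusPart (φt s)).toConvMap) (t := t)
      fun x => (isPolyCurve_plusPart h𝒢 hpoly x).differentiable_coeff 0 t
    refine ⟨fun t => atZero (plusPart (φt t)).toConvMap, D, fun _ => rfl, hD,
      hasDerivAt_betaFunction h𝒢 k hloc (fun t x => ?_) hD⟩
    simp only [hφt]
    exact hflow.equation t x
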